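/- **Setting.** Let $\Omega\subset\mathbb R^N$ be a bounded open set with $C^1$ boundary (connectedness is not needed) and outward unit normal $\nu$. For compact $K$, $f\in C^i(K)$ means that $f$ is the restriction to $K$ of a $C^i$ function on the whole space. Let $g^\pm\in C^1(\overline\Omega)$ with $g^-<g^+$ on $\overline\Omega$, and for $\varepsilon>0$ put $$\Omega_\varepsilon=\{(x,y): x\in\Omega,\ \varepsilon g^-(x)<y<\varepsilon g^+(x)\},$$ $$\partial_T\Omega_\varepsilon=\{x\in\overline\Omega,\ y=\varepsilon g^+(x)\},\quad \partial_B\Omega_\varepsilon=\{x\in\overline\Omega,\ y=\varepsilon g^-(x)\},\quad \partial_L\Omega_\varepsilon=\{x\in\partial\Omega,\ \varepsilon g^-(x)\le y\le\varepsilon g^+(x)\}.$$ Let $\mathcal S(N+1)$ be the space of real symmetric $(N+1)\times(N+1)$ matrices. **Assumptions.** 1. $F:\mathcal S(N+1)\times\mathbb R^{N+1}\times\mathbb R\times\overline\Omega\times[-1,1]\to\mathbb R$ is continuous, and there is $\alpha>0$ such that $F(X,p,r,x,y)-\alpha r\le F(Y,p,s,x,y)-\alpha s$ for all $(p,x,y)$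 whenever $X\ge Y$ and $r\le s$. 2. $\gamma^\pm=(\gamma_1^\pm,\gamma_2^\pm)\in C(\overline\Omega\times[-1,1],\mathbb R^{N+1})$ and $\beta^\pm\in C(\overline\Omega\times[-1,1])$, with $\gamma_2^+\equiv 1$ and $\gamma_2^-\equiv-1$. 3. For $x\in\overline\Omega$, $\beta^+(x,0)=-\beta^-(x,0)=:\beta_o(x)$ and $\gamma_1^+(x,0)=-\gamma_1^-(x,0)=:\gamma_o(x)$, with $\beta_o\in C^1(\overline\Omega)$ and $\gamma_o\in C^1(\overline\Omega,\mathbb R^N)$. 4. There are $k^\pm\in C(\overline\Omega,\mathbb R^N)$ and $l^\pm\in C(\overline\Omega)$ such that, as $y\to0$, uniformly in $x\in\overline\Omega$, $$\gamma_1^\pm(x,y)=\pm\gamma_o(x)+k^\pm(x)y+o(|y|),\qquad \beta^\pm(x,y)=\pm\beta_o(x)+l^\pm(x)y+o(|y|).$$ 5. The lateral operator $B$ is one of the following, with $\beta\in C(\partial\Omega\times[-1,1])$: * (oblique) $B(p,r,z)=\gamma(z)\cdot p-\beta(z)$, where $\gamma=(\gamma_1,\gamma_2)\in C(\partial\Omega\times[-1,1],\mathbb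 R^{N+1})$, $\gamma_1(x,y)\cdot\nu(x)>0$ on $\partial\Omega\times[-1,1]$ and $\gamma_2(x,0)=0$ on $\partial\Omega$; * (Dirichlet) $B(p,r,z)=r-\beta(z)$. **Problem.** $$(P_\varepsilon)\qquad F(D^2u,Du,u,x,y)=0\ \text{in }\Omega_\varepsilon,\quad \gamma^+\cdot Du=\beta^+\ \text{on }\partial_T\Omega_\varepsilon,\quad \gamma^-\cdot Du=\beta^-\ \text{on }\partial_B\Omega_\varepsilon,\quad B(Du,u,x,y)=0\ \text{on }\partial_L\Omega_\varepsilon.$$ A function $u$, bounded on $\overline{\Omega_\varepsilon}$, is a viscosity subsolution if its upper semicontinuous envelope $v$ on $\overline{\Omega_\varepsilon}$ satisfies the following. Whenever $\phi\in C^2(\overline{\Omega_\varepsilon})$ and $v-\phi$ has a maximum over $\overline{\Omega_\varepsilon}$ at $z$, consider the inequalities $$\text{(i) } F(D^2\phi(z),D\phi(z),v(z),z)\le0,\quad \text{(ii) } B(D\phi(z),v(z),z)\le0,\quad \text{(iii)}^\pm\ \gamma^\pm(z)\cdot D\phi(z)\le\beta^\pm(z).$$ Then * (i) holds if $z\in\Omega_\varepsilon$;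 * (i) or (ii) holds if $z\in\partial_L\Omega_\varepsilon\setminus(\partial_B\Omega_\varepsilon\cup\partial_T\Omega_\varepsilon)$; * (i) or (iii)$^-$ holds if $z\in\partial_B\Omega_\varepsilon\setminus\partial_L\Omega_\varepsilon$; * (i) or (iii)$^+$ holds if $z\in\partial_T\Omega_\varepsilon\setminus\partial_L\Omega_\varepsilon$; * (i), (ii) or (iii)$^-$ holds if $z\in\partial_L\Omega_\varepsilon\cap\partial_B\Omega_\varepsilon$; * (i), (ii) or (iii)$^+$ holds if $z\in\partial_L\Omega_\varepsilon\cap\partial_T\Omega_\varepsilon$. Supersolutions are defined with the lower semicontinuous envelope, minimum and $\ge$ in place of the upper semicontinuous envelope, maximum and $\le$. A viscosity solution is a function that is both a sub- and a supersolution. **Proposition.** For every $\varepsilon_0>0$ there are constants $\varepsilon_1\in(0,\varepsilon_0)$ and $C_0>0$ such that for every $\varepsilon\in(0,\varepsilon_1)$: $\overline{\Omega_\varepsilon}\subset\overline\Omega\times[-1,1]$; the problem $(P_\varepsilon)$ has a viscosity solution; and every viscosity solution $u$ of $(P_\varepsilon)$ satisfies $\sup_{\overline{\Omega_\varepsilon}}|u|\le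 C_0$. -/

import Mathlib

open Set Filter Topology

noncomputable section

namespace ThinDomain

/-- `ℝ^N` with its Euclidean structure (the variable `x`). -/
abbrev Base (N : ℕ) : Type := EuclideanSpace ℝ (Fin N)

/-- `ℝ^{N+1} = ℝ^N × ℝ`, points `(x, y)` and vectors `(p₁, p₂)`. -/
abbrev Pt (N : ℕ) : Type := Base N × ℝ

/-- `(N+1) × (N+1)` real matrices, in blocks `N + 1`. -/
abbrev Mat (N : ℕ) : Type := Matrix (Fin N ⊕ Unit) (Fin N ⊕ Unit) ℝ

/-- The Euclidean scalar product of `ℝ^{N+1}`. -/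
def dot {N : ℕ} (a b : Pt N) : ℝ := inner ℝ a.1 b.1 + a.2 * b.2

/-- The standard basis of `ℝ^{N+1}`. -/
def dir {N : ℕ} : Fin N ⊕ Unit → Pt N
  | Sum.inl i => (EuclideanSpace.single i 1, 0)
  | Sum.inr _ => (0, 1)

/-- The gradient `Dφ = (D_x φ, φ_y)`. -/
def grad {N : ℕ} (φ : Pt N → ℝ) (z : Pt N) : Pt N :=
  (WithLp.toLp 2 fun i => fderiv ℝ φ z (dir (Sum.inl i)), fderiv ℝ φ z (dir (Sum.inr ())))

/-- The Hessian matrix `D²φ`. -/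
def hess {N : ℕ} (φ : Pt N → ℝ) (z : Pt N) : Mat N :=
  Matrix.of fun i j => fderiv ℝ (fderiv ℝ φ) z (dir i) (dir j)

/-- `f ∈ C¹(K)`: `f` is on `K` the restriction of a `C¹` function on the whole space. -/
def IsC1On {E G : Type*} [NormedAddCommGroup E] [NormedSpace ℝ E]
    [NormedAddCommGroup G] [NormedSpace ℝ G] (f : E → G) (K : Set E) : Prop :=
  ∃ h : E → G, ContDiff ℝ 1 h ∧ EqOn f h K

/-- `ρ` is a `C¹` function near `x`, with nonzero gradient at `x`, and near `x` the set `Ω` is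
`{ρ < 0}`. -/
def IsLocalDefiningFunction {N : ℕ} (Ω : Set (Base N)) (x : Base N) (ρ : Base N → ℝ) : Prop :=
  ContDiffAt ℝ 1 ρ x ∧ gradient ρ x ≠ 0 ∧ ∀ᶠ z in 𝓝 x, (z ∈ Ω ↔ ρ z < 0)

/-- `Ω` has a `C¹` boundary. -/
def HasC1Boundary {N : ℕ} (Ω : Set (Base N)) : Prop :=
  ∀ x ∈ frontier Ω, ∃ ρ : Base N → ℝ, IsLocalDefiningFunction Ω x ρ

/-- `n` is the outward unit normal `ν(x)` to `∂Ω` at `x`. -/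
def IsOutwardUnitNormal {N : ℕ} (Ω : Set (Base N)) (x n : Base N) : Prop :=
  ∃ ρ : Base N → ℝ, IsLocalDefiningFunction Ω x ρ ∧ n = ‖gradient ρ x‖⁻¹ • gradient ρ x

/-- The domain `closure Ω × [-1, 1]` of the data. -/
def dataDomain {N : ℕ} (Ω : Set (Base N)) : Set (Pt N) := closure Ω ×ˢ Icc (-1 : ℝ) 1

/-- The lateral set `∂Ω × [-1, 1]`. -/
def lateralDataDomain {N : ℕ} (Ω : Set (Base N)) : Set (Pt N) := frontier Ω ×ˢ Icc (-1 : ℝ) 1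

/-- Continuity of `F(X, p, r, (x, y))` on `S(N+1) × ℝ^{N+1} × ℝ × closure Ω × [-1, 1]`, degenerate
ellipticity, and strict monotonicity in `r`. Only values at symmetric `X` are constrained (and
used, since Hessians of `C²` functions are symmetric). -/
def IsProperElliptic {N : ℕ} (Ω : Set (Base N)) (F : Mat N → Pt N → ℝ → Pt N → ℝ) : Prop :=
  ContinuousOn (fun q : Mat N × Pt N × ℝ × Pt N => F q.1 q.2.1 q.2.2.1 q.2.2.2)
      {q | q.1.IsSymm ∧ q.2.2.2 ∈ dataDomain Ω} ∧
    ∃ α : ℝ, 0 < α ∧ ∀ (p : Pt N), ∀ z ∈ dataDomain Ω, ∀ X Y : Mat N, X.IsSymm → Y.IsSymm →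
      (X - Y).PosSemidef → ∀ r s : ℝ, r ≤ s → F X p r z - α * r ≤ F Y p s z - α * s

/-- `f(x, y) = f₀(x) + y f₁(x) + o(|y|)` as `y → 0`, uniformly for `x ∈ closure Ω`. -/
def HasUniformExpansion {N : ℕ} {G : Type*} [NormedAddCommGroup G] [NormedSpace ℝ G]
    (Ω : Set (Base N)) (f : Pt N → G) (f₀ f₁ : Base N → G) : Prop :=
  ∀ η : ℝ, 0 < η → ∃ δ : ℝ, 0 < δ ∧ ∀ x ∈ closure Ω, ∀ y ∈ Icc (-1 : ℝ) 1, |y| < δ →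
    ‖f (x, y) - (f₀ x + y • f₁ x)‖ ≤ η * |y|

/-- The thin domain `Ω_ε`. -/
def thin {N : ℕ} (Ω : Set (Base N)) (gm gp : Base N → ℝ) (ε : ℝ) : Set (Pt N) :=
  {z | z.1 ∈ Ω ∧ ε * gm z.1 < z.2 ∧ z.2 < ε * gp z.1}

/-- The top of the boundary. -/
def top {N : ℕ} (Ω : Set (Base N)) (gp : Base N → ℝ) (ε : ℝ) : Set (Pt N) :=
  {z | z.1 ∈ closure Ω ∧ z.2 = ε * gp z.1}

/-- The bottom of the boundary. -/
def bottom {N : ℕ} (Ω : Set (Base N)) (gm : Base N → ℝ) (ε : ℝ) : Set (Pt N) :=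
  {z | z.1 ∈ closure Ω ∧ z.2 = ε * gm z.1}

/-- The lateral part of the boundary. -/
def lateral {N : ℕ} (Ω : Set (Base N)) (gm gp : Base N → ℝ) (ε : ℝ) : Set (Pt N) :=
  {z | z.1 ∈ frontier Ω ∧ ε * gm z.1 ≤ z.2 ∧ z.2 ≤ ε * gp z.1}

/-- The operator `B(p, r, z) = γ(z) · p - β(z)` of the oblique lateral condition. -/
def obliqueOp {N : ℕ} (γ : Pt N → Pt N) (β : Pt N → ℝ) : Pt N → ℝ → Pt N → ℝ :=
  fun p _ z => dot (γ z) p - β z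

/-- The operator `B(p, r, z) = r - β(z)` of the Dirichlet lateral condition. -/
def dirichletOp {N : ℕ} (β : Pt N → ℝ) : Pt N → ℝ → Pt N → ℝ :=
  fun _ r z => r - β z

/-- Admissible lateral operators: an oblique condition with continuous `γ = (γ₁, γ₂)` and `β`,
`γ₁ · ν > 0` and `γ₂(x, 0) = 0`, or a Dirichlet condition with continuous `β`. -/
def IsLateralOp {N : ℕ} (Ω : Set (Base N)) (B : Pt N → ℝ → Pt N → ℝ) : Prop :=
  (∃ (γ : Pt N → Pt N) (β : Pt N → ℝ),
      ContinuousOn γ (lateralDataDomain Ω) ∧ ContinuousOn β (lateralDataDomain Ω) ∧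
      (∀ x ∈ frontier Ω, ∀ n, IsOutwardUnitNormal Ω x n → ∀ y ∈ Icc (-1 : ℝ) 1,
        0 < inner ℝ (γ (x, y)).1 n) ∧
      (∀ x ∈ frontier Ω, (γ (x, 0)).2 = 0) ∧
      B = obliqueOp γ β) ∨
    ∃ β : Pt N → ℝ, ContinuousOn β (lateralDataDomain Ω) ∧ B = dirichletOp β

/-- The upper semicontinuous envelope on `K` of `u`, bounded on `K` (for points of `K`; the filter
`𝓝[K] z` sees the point `z` itself). -/
def uscEnv {N : ℕ} (K : Set (Pt N)) (u : Pt N → ℝ) (z : Pt N) : ℝ := limsup u (𝓝[K] z)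

/-- The lower semicontinuous envelope on `K`. -/
def lscEnv {N : ℕ} (K : Set (Pt N)) (u : Pt N → ℝ) (z : Pt N) : ℝ := liminf u (𝓝[K] z)

/-- `u` is bounded on `K`. -/
def IsBddOn {N : ℕ} (K : Set (Pt N)) (u : Pt N → ℝ) : Prop := ∃ C : ℝ, ∀ z ∈ K, |u z| ≤ C

/-- Viscosity subsolutions of `F(D²u, Du, u, x, y) = 0` in `Ω_ε`, `γ^± · Du = β^±` on the top and
the bottom, `B(Du, u, x, y) = 0` on the lateral boundary. -/
def IsViscositySubsolution {N : ℕ} (Ω : Set (Base N)) (gm gp : Base N → ℝ) (ε : ℝ)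
    (F : Mat N → Pt N → ℝ → Pt N → ℝ) (γm γp : Pt N → Pt N) (βm βp : Pt N → ℝ)
    (B : Pt N → ℝ → Pt N → ℝ) (u : Pt N → ℝ) : Prop :=
  let K := closure (thin Ω gm gp ε)
  let T := top Ω gp ε
  let S := bottom Ω gm ε
  let L := lateral Ω gm gp ε
  let v := uscEnv K u
  IsBddOn K u ∧
    ∀ φ : Pt N → ℝ, ContDiff ℝ 2 φ → ∀ z ∈ K, IsMaxOn (fun w => v w - φ w) K z →
      let eqn : Prop := F (hess φ z) (grad φ z) (v z) z ≤ 0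
      let lat : Prop := B (grad φ z) (v z) z ≤ 0
      let bot : Prop := dot (γm z) (grad φ z) ≤ βm z
      let tp : Prop := dot (γp z) (grad φ z) ≤ βp z
      (z ∈ thin Ω gm gp ε → eqn) ∧
      (z ∈ L \ (S ∪ T) → eqn ∨ lat) ∧
      (z ∈ S \ L → eqn ∨ bot) ∧
      (z ∈ T \ L → eqn ∨ tp) ∧
      (z ∈ L ∩ S → eqn ∨ lat ∨ bot) ∧
      (z ∈ L ∩ T → eqn ∨ lat ∨ tp)

/-- Viscosity supersolutions of the same problem. -/
def IsViscositySupersolution {N : ℕ} (Ω : Set (Base N)) (gm gp : Base N → ℝ) (ε : ℝ)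
    (F : Mat N → Pt N → ℝ → Pt N → ℝ) (γm γp : Pt N → Pt N) (βm βp : Pt N → ℝ)
    (B : Pt N → ℝ → Pt N → ℝ) (u : Pt N → ℝ) : Prop :=
  let K := closure (thin Ω gm gp ε)
  let T := top Ω gp ε
  let S := bottom Ω gm ε
  let L := lateral Ω gm gp ε
  let v := lscEnv K u
  IsBddOn K u ∧
    ∀ φ : Pt N → ℝ, ContDiff ℝ 2 φ → ∀ z ∈ K, IsMinOn (fun w => v w - φ w) K z →
      let eqn : Prop := 0 ≤ F (hess φ z) (grad φ z) (v z) z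
      let lat : Prop := 0 ≤ B (grad φ z) (v z) z
      let bot : Prop := βm z ≤ dot (γm z) (grad φ z)
      let tp : Prop := βp z ≤ dot (γp z) (grad φ z)
      (z ∈ thin Ω gm gp ε → eqn) ∧
      (z ∈ L \ (S ∪ T) → eqn ∨ lat) ∧
      (z ∈ S \ L → eqn ∨ bot) ∧
      (z ∈ T \ L → eqn ∨ tp) ∧
      (z ∈ L ∩ S → eqn ∨ lat ∨ bot) ∧
      (z ∈ L ∩ T → eqn ∨ lat ∨ tp)

/-- Viscosity solutions: both sub- and supersolutions. -/
def IsViscositySolution {N : ℕ} (Ω : Set (Base N)) (gm gp : Base N → ℝ) (ε : ℝ)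
    (F : Mat N → Pt N → ℝ → Pt N → ℝ) (γm γp : Pt N → Pt N) (βm βp : Pt N → ℝ)
    (B : Pt N → ℝ → Pt N → ℝ) (u : Pt N → ℝ) : Prop :=
  IsViscositySubsolution Ω gm gp ε F γm γp βm βp B u ∧
    IsViscositySupersolution Ω gm gp ε F γm γp βm βp B u

end ThinDomain

end

/-! Existence and uniform bounds for a fully nonlinear problem in thin domains.

Both assertions rest on one construction, a strict classical supersolution that is bounded uniformly
in `ε` (`exists_strict_supersolution`). At leading order the oblique
conditions on the top and the bottom coincide, and prescribe the vertical derivative of a barrier with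
leading part `ψ(x)` as `β₀ - γ₀ · Dψ`. This suggests `ψ(x) + y f(x) + (A/2) (y - ε m(x))² + C` with
`f = β₀ - γ₀ · Dψ` and `m = (g⁺ + g⁻)/2`: the terms of order one cancel on the top and the bottom, and
for large `A` the quadratic term has the right sign on both and dominates what is left at order `ε`
(`le_fderiv_ansatz`). The weight `ψ` takes care of an oblique lateral condition, and the constant `C`
of the equation, by strict monotonicity in `r`, and of a Dirichlet condition. Since `f` and `m` are
only `C¹`, they are mollified at scale `ε`: the error is `O(ε)`, hence absorbed by `A`, and the second
derivatives are `O(1/ε)`, hence harmless after multiplication by `y = O(ε)`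
(`exists_smooth_approx_of_contDiff`, `ansatz_jet_le`). Applying the construction to the data
reflected by `u ↦ -u` gives a strict subsolution. Comparison of a viscosity solution with a strict
classical barrier needs only the definition, so the bound follows at once.

Existence is Perron's method (`exists_isSub_isSuper`). No comparison principle is required, since
solutions may be discontinuous and the strict barriers already bound all subsolutions. The one
property of the boundary conditions that enters is that a strict classical subsolution is a viscosity
subsolution (`subIneq_of_touching`). In the interior this is ellipticity. At the boundary it holds
because some combination, with nonnegative coefficients, of the oblique vectors active at the point
is the opposite of a direction pointing into the domain
(`eventually_pointsInto_top_bottom`, `eventually_pointsInto_lateral`). At the edges, where a lateral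
and a horizontal condition meet, this uses that `ε` is small and that `γ₂` vanishes at `y = 0`.
-/

noncomputable section

namespace ThinDomain

/-! ### Jets of `C²` functions -/

theorem sum_smul_dir {N : ℕ} (d : Pt N) :
    ∑ i : Fin N, d.1 i • dir (Sum.inl i) + d.2 • dir (Sum.inr ()) = d := by
  refine Prod.ext ?_ ?_
  · ext j
    simp [dir, Prod.fst_sum, Pi.single_apply]
  · simp [dir, Prod.snd_sum]

theorem dot_grad {N : ℕ} (φ : Pt N → ℝ) (z d : Pt N) : dot d (grad φ z) = fderiv ℝ φ z d := by
  conv_rhs => rw [← sum_smul_dir d]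
  rw [map_add, map_sum]
  simp [dot, grad, PiLp.inner_apply, mul_comm]

theorem contDiff_one_fderiv {N : ℕ} {φ : Pt N → ℝ} (hφ : ContDiff ℝ 2 φ) :
    ContDiff ℝ 1 (fderiv ℝ φ) :=
  hφ.fderiv_right (by norm_num)

theorem continuous_grad {N : ℕ} {φ : Pt N → ℝ} (hφ : ContDiff ℝ 2 φ) : Continuous (grad φ) := by
  have h := (contDiff_one_fderiv hφ).continuous
  unfold grad
  fun_prop

theorem continuous_hess {N : ℕ} {φ : Pt N → ℝ} (hφ : ContDiff ℝ 2 φ) : Continuous (hess φ) := by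
  have h := (contDiff_one_fderiv hφ).continuous_fderiv one_ne_zero
  refine continuous_matrix fun i j => ?_
  simp only [hess, Matrix.of_apply]
  fun_prop

theorem hess_isSymm {N : ℕ} {φ : Pt N → ℝ} (hφ : ContDiff ℝ 2 φ) (z : Pt N) :
    (hess φ z).IsSymm := by
  ext i j
  simp only [hess, Matrix.transpose_apply, Matrix.of_apply]
  exact (hφ.contDiffAt.isSymmSndFDerivAt (by simp)) _ _

theorem grad_neg {N : ℕ} (φ : Pt N → ℝ) (z : Pt N) : grad (fun w => -φ w) z = -grad φ z := by
  refine Prod.ext ?_ ?_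
  · ext i; simp [grad, fderiv_fun_neg]
  · simp [grad, fderiv_fun_neg]

theorem hess_neg {N : ℕ} (φ : Pt N → ℝ) (z : Pt N) : hess (fun w => -φ w) z = -hess φ z := by
  have h : fderiv ℝ (fun w => -φ w) = fun w => -fderiv ℝ φ w := by
    funext w; rw [fderiv_fun_neg]
  ext i j
  simp [hess, h, fderiv_fun_neg]

theorem grad_add_eq {N : ℕ} {φ q : Pt N → ℝ} (hφ : ContDiff ℝ 2 φ) (hq : ContDiff ℝ 2 q)
    {z : Pt N} (h : fderiv ℝ q z = 0) : grad (fun w => φ w + q w) z = grad φ z := by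
  have : fderiv ℝ (fun w => φ w + q w) z = fderiv ℝ φ z := by
    rw [fderiv_fun_add (hφ.differentiable (by norm_num) z) (hq.differentiable (by norm_num) z), h,
      add_zero]
  simp [grad, this]

theorem hess_add_eq {N : ℕ} {φ q : Pt N → ℝ} (hφ : ContDiff ℝ 2 φ) (hq : ContDiff ℝ 2 q)
    {z : Pt N} (h : fderiv ℝ (fderiv ℝ q) z = 0) : hess (fun w => φ w + q w) z = hess φ z := by
  have h1 : fderiv ℝ (fun w => φ w + q w) = fun w => fderiv ℝ φ w + fderiv ℝ q w := by
    funext w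
    rw [fderiv_fun_add (hφ.differentiable (by norm_num) w) (hq.differentiable (by norm_num) w)]
  have h2 : fderiv ℝ (fderiv ℝ (fun w => φ w + q w)) z = fderiv ℝ (fderiv ℝ φ) z := by
    rw [h1, fderiv_fun_add ((contDiff_one_fderiv hφ).differentiable one_ne_zero z)
      ((contDiff_one_fderiv hq).differentiable one_ne_zero z), h, add_zero]
  simp [hess, h2]

theorem grad_add_const {N : ℕ} (φ : Pt N → ℝ) (c : ℝ) (z : Pt N) :
    grad (fun w => φ w + c) z = grad φ z := by
  simp [grad, fderiv_add_const]

theorem hess_add_const {N : ℕ} (φ : Pt N → ℝ) (c : ℝ) (z : Pt N) :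
    hess (fun w => φ w + c) z = hess φ z := by
  have : fderiv ℝ (fun w => φ w + c) = fderiv ℝ φ := by funext w; simp
  simp [hess, this]

/-- The fourth power of the Euclidean distance to `z₀`: a `C²` function with a strict minimum at
`z₀` whose `2`-jet vanishes there. -/
def quartic {N : ℕ} (z₀ w : Pt N) : ℝ := (‖w.1 - z₀.1‖ ^ 2 + (w.2 - z₀.2) ^ 2) ^ 2

theorem contDiff_quartic {N : ℕ} (z₀ : Pt N) : ContDiff ℝ 2 (quartic z₀) := by
  unfold quartic
  have : ContDiff ℝ 2 fun w : Pt N => ‖w.1 - z₀.1‖ ^ 2 :=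
    (contDiff_fst.sub contDiff_const).norm_sq ℝ
  fun_prop

theorem quartic_self {N : ℕ} (z₀ : Pt N) : quartic z₀ z₀ = 0 := by simp [quartic]

theorem quartic_nonneg {N : ℕ} (z₀ w : Pt N) : 0 ≤ quartic z₀ w := sq_nonneg _

theorem pow_le_quartic {N : ℕ} {z₀ w : Pt N} {r : ℝ} (hr : 0 ≤ r) (h : r ≤ dist w z₀) :
    r ^ 4 ≤ quartic z₀ w := by
  have h2 : r ^ 2 ≤ ‖w.1 - z₀.1‖ ^ 2 + (w.2 - z₀.2) ^ 2 := by
    rw [Prod.dist_eq, le_max_iff, dist_eq_norm, Real.dist_eq] at h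
    rcases h with h | h
    · nlinarith [sq_nonneg (w.2 - z₀.2)]
    · rw [← sq_abs (w.2 - z₀.2)]; nlinarith [sq_nonneg ‖w.1 - z₀.1‖]
  calc r ^ 4 = (r ^ 2) ^ 2 := by ring
    _ ≤ quartic z₀ w := pow_le_pow_left₀ (sq_nonneg r) h2 2

theorem fderiv_quartic_self {N : ℕ} (z₀ : Pt N) :
    fderiv ℝ (quartic z₀) z₀ = 0 ∧ fderiv ℝ (fderiv ℝ (quartic z₀)) z₀ = 0 := by
  set s : Pt N → ℝ := fun w => ‖w.1 - z₀.1‖ ^ 2 + (w.2 - z₀.2) ^ 2 with hs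
  have hsc : ContDiff ℝ 2 s := by
    have : ContDiff ℝ 2 fun w : Pt N => ‖w.1 - z₀.1‖ ^ 2 :=
      (contDiff_fst.sub contDiff_const).norm_sq ℝ
    fun_prop
  have hd := hsc.differentiable (by norm_num)
  have s0 : s z₀ = 0 := by simp [hs]
  have hds : fderiv ℝ s z₀ = 0 := by
    refine IsLocalMin.fderiv_eq_zero (Filter.Eventually.of_forall fun w => ?_)
    rw [s0]; positivity
  have hq : fderiv ℝ (quartic z₀) = fun w => (2 * s w) • fderiv ℝ s w := by
    funext w
    have : quartic z₀ = fun w => s w ^ 2 := rfl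
    rw [this, fderiv_fun_pow 2 (hd w)]
    simp
  refine ⟨by rw [hq]; simp [s0], ?_⟩
  rw [hq, fderiv_fun_smul ((hd z₀).const_mul 2)
    ((contDiff_one_fderiv hsc).differentiable one_ne_zero z₀)]
  rw [fderiv_const_mul (hd z₀), hds, s0]
  simp only [mul_zero, zero_smul, smul_zero, zero_add]
  exact ContinuousLinearMap.ext fun v => by simp

/-- A function with a local maximum on the line through `z` has nonpositive second derivative. -/
theorem fderiv_fderiv_nonpos_of_isLocalMax {E : Type*} [NormedAddCommGroup E] [NormedSpace ℝ E]
    {f : E → ℝ} (hf : ContDiff ℝ 2 f) {z : E} (hz : IsLocalMax f z) (v : E) :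
    fderiv ℝ (fderiv ℝ f) z v v ≤ 0 := by
  by_contra! hpos
  set g : ℝ → ℝ := fun t => f (z + t • v) with hg
  have hl : ∀ t : ℝ, HasDerivAt (fun t : ℝ => z + t • v) v t := fun t => by
    simpa using ((hasDerivAt_id t).smul_const v).const_add z
  have hg1 : ∀ t, HasDerivAt g (fderiv ℝ f (z + t • v) v) t := fun t =>
    ((hf.differentiable (by norm_num) _).hasFDerivAt).comp_hasDerivAt t (hl t)
  have hdg : deriv g = fun t => fderiv ℝ f (z + t • v) v := funext fun t => (hg1 t).deriv
  have hf1 : ContDiff ℝ 1 (fderiv ℝ f) := hf.fderiv_right (by norm_num)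
  have hg2 : HasDerivAt (deriv g) (fderiv ℝ (fderiv ℝ f) z v v) 0 := by
    rw [hdg]
    have h0 : HasFDerivAt (fderiv ℝ f) (fderiv ℝ (fderiv ℝ f) z) (z + (0 : ℝ) • v) := by
      simpa using (hf1.differentiable one_ne_zero z).hasFDerivAt
    have h := h0.comp_hasDerivAt (0 : ℝ) (hl 0)
    simpa using h.clm_apply (hasDerivAt_const (0 : ℝ) v)
  have hloc : IsLocalMax g 0 := by
    have hc : Tendsto (fun t : ℝ => z + t • v) (𝓝 0) (𝓝 z) := by
      have := (hl 0).continuousAt.tendsto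
      simpa using this
    have := hc.eventually hz
    filter_upwards [this] with t ht
    simpa [hg] using ht
  have hmin : IsLocalMin g 0 := by
    refine isLocalMin_of_deriv_deriv_pos ?_ hloc.deriv_eq_zero (hg1 0).continuousAt
    rw [hg2.deriv]; exact hpos
  have hconst : g =ᶠ[𝓝 0] fun _ => g 0 := by
    filter_upwards [hloc, hmin] with t h1 h2 using le_antisymm h1 h2
  have h2 : deriv (deriv g) 0 = 0 := by
    rw [hconst.deriv.deriv_eq]; simp
  rw [hg2.deriv] at h2
  exact hpos.ne' h2

theorem posSemidef_hess_sub {N : ℕ} {φ χ : Pt N → ℝ} (hφ : ContDiff ℝ 2 φ) (hχ : ContDiff ℝ 2 χ)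
    {z : Pt N} (hz : IsLocalMax (fun w => φ w - χ w) z) :
    (hess χ z - hess φ z).PosSemidef := by
  refine Matrix.posSemidef_iff_dotProduct_mulVec.mpr ⟨?_, fun x => ?_⟩
  · have := (hess_isSymm hχ z).sub (hess_isSymm hφ z)
    rw [Matrix.IsHermitian, Matrix.conjTranspose_eq_transpose_of_trivial]
    exact this
  set v : Pt N := ∑ i, x i • dir i with hv
  have h := fderiv_fderiv_nonpos_of_isLocalMax (hφ.sub hχ) hz v
  have h1 : fderiv ℝ (fun w => φ w - χ w) = fun w => fderiv ℝ φ w - fderiv ℝ χ w := by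
    funext w
    rw [fderiv_fun_sub (hφ.differentiable (by norm_num) w) (hχ.differentiable (by norm_num) w)]
  have h2 : fderiv ℝ (fderiv ℝ (fun w => φ w - χ w)) z
      = fderiv ℝ (fderiv ℝ φ) z - fderiv ℝ (fderiv ℝ χ) z := by
    rw [h1, fderiv_fun_sub ((contDiff_one_fderiv hφ).differentiable one_ne_zero z)
      ((contDiff_one_fderiv hχ).differentiable one_ne_zero z)]
  have h3 : ∀ D : Pt N →L[ℝ] Pt N →L[ℝ] ℝ, D v v = ∑ i, ∑ j, x i * (D (dir i) (dir j) * x j) := by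
    intro D
    have e : D v = ∑ i, x i • D (dir i) := by rw [hv, map_sum]; simp only [map_smul]
    rw [e, sum_apply]
    refine Finset.sum_congr rfl fun i _ => ?_
    rw [smul_apply, hv, map_sum, smul_eq_mul, Finset.mul_sum]
    refine Finset.sum_congr rfl fun j _ => ?_
    rw [map_smul, smul_eq_mul]; ring
  have h4 : star x ⬝ᵥ ((hess χ z - hess φ z).mulVec x)
      = fderiv ℝ (fderiv ℝ χ) z v v - fderiv ℝ (fderiv ℝ φ) z v v := by
    rw [h3, h3, ← Finset.sum_sub_distrib]
    simp only [dotProduct, Matrix.mulVec, Finset.mul_sum, Pi.star_apply, star_trivial, hess,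
      Matrix.sub_apply, Matrix.of_apply]
    refine Finset.sum_congr rfl fun i _ => ?_
    rw [← Finset.sum_sub_distrib]
    refine Finset.sum_congr rfl fun j _ => ?_
    ring
  rw [h4]
  change fderiv ℝ (fderiv ℝ fun w => φ w - χ w) z v v ≤ 0 at h
  rw [h2] at h
  simp only [sub_apply] at h
  linarith

/-! ### Semicontinuous envelopes of bounded functions -/

section Envelope

variable {N : ℕ} {K : Set (Pt N)} {u : Pt N → ℝ} {z : Pt N}

theorem IsBddOn.isBoundedUnder_le (hu : IsBddOn K u) : IsBoundedUnder (· ≤ ·) (𝓝[K] z) u := by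
  obtain ⟨C, hC⟩ := hu
  exact ⟨C, eventually_map.2 (eventually_nhdsWithin_of_forall fun w hw => (abs_le.1 (hC w hw)).2)⟩

theorem IsBddOn.isBoundedUnder_ge (hu : IsBddOn K u) : IsBoundedUnder (· ≥ ·) (𝓝[K] z) u := by
  obtain ⟨C, hC⟩ := hu
  exact ⟨-C, eventually_map.2 (eventually_nhdsWithin_of_forall fun w hw => (abs_le.1 (hC w hw)).1)⟩

theorem frequently_nhdsWithin_of_self {p : Pt N → Prop} (hz : z ∈ K) (hp : p z) :
    ∃ᶠ w in 𝓝[K] z, p w := fun h =>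
  (eventually_nhdsWithin_iff.1 h).self_of_nhds hz hp

theorem le_uscEnv (hu : IsBddOn K u) (hz : z ∈ K) : u z ≤ uscEnv K u z :=
  le_limsup_of_frequently_le (frequently_nhdsWithin_of_self hz le_rfl) hu.isBoundedUnder_le

theorem lscEnv_le (hu : IsBddOn K u) (hz : z ∈ K) : lscEnv K u z ≤ u z :=
  liminf_le_of_frequently_le (frequently_nhdsWithin_of_self hz le_rfl) hu.isBoundedUnder_ge

theorem uscEnv_le (hu : IsBddOn K u) (hz : z ∈ K) {a : ℝ} (h : ∀ᶠ w in 𝓝[K] z, u w ≤ a) :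
    uscEnv K u z ≤ a := by
  have : (𝓝[K] z).NeBot := mem_closure_iff_nhdsWithin_neBot.1 (subset_closure hz)
  exact limsup_le_of_le hu.isBoundedUnder_ge.isCoboundedUnder_le h

theorem le_lscEnv (hu : IsBddOn K u) (hz : z ∈ K) {a : ℝ} (h : ∀ᶠ w in 𝓝[K] z, a ≤ u w) :
    a ≤ lscEnv K u z := by
  have : (𝓝[K] z).NeBot := mem_closure_iff_nhdsWithin_neBot.1 (subset_closure hz)
  exact le_liminf_of_le hu.isBoundedUnder_le.isCoboundedUnder_ge h

theorem frequently_lt_of_lt_uscEnv (hu : IsBddOn K u) (hz : z ∈ K) {a : ℝ}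
    (h : a < uscEnv K u z) : ∃ᶠ w in 𝓝[K] z, a < u w := by
  have : (𝓝[K] z).NeBot := mem_closure_iff_nhdsWithin_neBot.1 (subset_closure hz)
  exact frequently_lt_of_lt_limsup hu.isBoundedUnder_ge.isCoboundedUnder_le h

theorem upperSemicontinuousOn_uscEnv (hu : IsBddOn K u) :
    UpperSemicontinuousOn (uscEnv K u) K := by
  intro z _ a ha
  obtain ⟨b, hb, hba⟩ := exists_between ha
  have h : ∀ᶠ w in 𝓝[K] z, u w < b := eventually_lt_of_limsup_lt hb hu.isBoundedUnder_le
  filter_upwards [eventually_eventually_nhdsWithin.2 h, self_mem_nhdsWithin] with w hw hwK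
  exact (uscEnv_le hu hwK (hw.mono fun _ => le_of_lt)).trans_lt hba

theorem lowerSemicontinuousOn_lscEnv (hu : IsBddOn K u) :
    LowerSemicontinuousOn (lscEnv K u) K := by
  intro z _ a ha
  obtain ⟨b, hab, hb⟩ := exists_between ha
  have h : ∀ᶠ w in 𝓝[K] z, b < u w := eventually_lt_of_lt_liminf hb hu.isBoundedUnder_ge
  filter_upwards [eventually_eventually_nhdsWithin.2 h, self_mem_nhdsWithin] with w hw hwK
  exact hab.trans_le (le_lscEnv hu hwK (hw.mono fun _ => le_of_lt))

theorem upperSemicontinuousOn_sub {v φ : Pt N → ℝ} (hv : UpperSemicontinuousOn v K)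
    (hφ : Continuous φ) : UpperSemicontinuousOn (fun w => v w - φ w) K := by
  have h := hv.add (hφ.neg.continuousOn.upperSemicontinuousOn)
  intro z hz a ha
  simp only [sub_eq_add_neg] at ha ⊢
  exact h z hz a ha

theorem lowerSemicontinuousOn_sub {v φ : Pt N → ℝ} (hv : LowerSemicontinuousOn v K)
    (hφ : Continuous φ) : LowerSemicontinuousOn (fun w => v w - φ w) K := by
  have h := hv.add (hφ.neg.continuousOn.lowerSemicontinuousOn)
  intro z hz a ha
  simp only [sub_eq_add_neg] at ha ⊢
  exact h z hz a ha

end Envelope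

/-! ### Perron's method for an abstract pair of viscosity inequalities -/

/-- Upper semicontinuous functions on `K` that satisfy the viscosity inequality `P`: at each maximum
`z` of `v - φ` over `K`, the jet of `φ` and the value `v z` satisfy `P`. -/
def IsSub {N : ℕ} (K : Set (Pt N)) (P : Mat N → Pt N → ℝ → Pt N → Prop) (v : Pt N → ℝ) : Prop :=
  UpperSemicontinuousOn v K ∧ ∀ φ : Pt N → ℝ, ContDiff ℝ 2 φ → ∀ z ∈ K,
    IsMaxOn (fun w => v w - φ w) K z → P (hess φ z) (grad φ z) (v z) z

/-- Lower semicontinuous functions on `K` that satisfy the viscosity inequality `Q` at the minima of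
`v - φ`. -/
def IsSuper {N : ℕ} (K : Set (Pt N)) (Q : Mat N → Pt N → ℝ → Pt N → Prop) (v : Pt N → ℝ) : Prop :=
  LowerSemicontinuousOn v K ∧ ∀ φ : Pt N → ℝ, ContDiff ℝ 2 φ → ∀ z ∈ K,
    IsMinOn (fun w => v w - φ w) K z → Q (hess φ z) (grad φ z) (v z) z

/-- The failure of `P` is an open condition along the jets of each `C²` function. -/
def IsClosedAlongJets {N : ℕ} (K : Set (Pt N)) (P : Mat N → Pt N → ℝ → Pt N → Prop) : Prop :=
  ∀ φ : Pt N → ℝ, ContDiff ℝ 2 φ → ∀ z ∈ K, ∀ r : ℝ, ¬ P (hess φ z) (grad φ z) r z →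
    ∀ᶠ q in 𝓝[K] z ×ˢ 𝓝 r, ¬ P (hess φ q.1) (grad φ q.1) q.2 q.1

section Perron

variable {N : ℕ} {K : Set (Pt N)} {P Q : Mat N → Pt N → ℝ → Pt N → Prop}

theorem IsSub.le_of_strict {v φ : Pt N → ℝ} (hK : IsCompact K) (hv : IsSub K P v)
    (hφ : ContDiff ℝ 2 φ)
    (h : ∀ z ∈ K, ∀ r, φ z < r → ¬ P (hess φ z) (grad φ z) r z) {z : Pt N} (hz : z ∈ K) :
    v z ≤ φ z := by
  have hc : UpperSemicontinuousOn (fun w => v w - φ w) K := upperSemicontinuousOn_sub hv.1 hφ.continuous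
  obtain ⟨w, hw, hmax⟩ := hc.exists_isMaxOn ⟨z, hz⟩ hK
  have hle : v w ≤ φ w := by
    by_contra! hlt
    exact h w hw _ hlt (hv.2 φ hφ w hw hmax)
  have := hmax hz
  simp only [mem_ofPred_eq] at this
  linarith

theorem IsSuper.le_of_strict {v φ : Pt N → ℝ} (hK : IsCompact K) (hv : IsSuper K Q v)
    (hφ : ContDiff ℝ 2 φ)
    (h : ∀ z ∈ K, ∀ r, r < φ z → ¬ Q (hess φ z) (grad φ z) r z) {z : Pt N} (hz : z ∈ K) :
    φ z ≤ v z := by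
  have hc : LowerSemicontinuousOn (fun w => v w - φ w) K := lowerSemicontinuousOn_sub hv.1 hφ.continuous
  obtain ⟨w, hw, hmin⟩ := hc.exists_isMinOn ⟨z, hz⟩ hK
  have hle : φ w ≤ v w := by
    by_contra! hlt
    exact h w hw _ hlt (hv.2 φ hφ w hw hmin)
  have := hmin hz
  simp only [mem_ofPred_eq] at this
  linarith

/-- Stability under suprema: if near-maximal values of a bounded `u` are attained by subsolutions
lying below `u`, then the upper envelope of `u` is a subsolution. -/
theorem isSub_uscEnv (hK : IsCompact K) (hP : IsClosedAlongJets K P) {u : Pt N → ℝ}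
    (hu : IsBddOn K u)
    (hsup : ∀ z ∈ K, ∀ a < u z, ∃ w, IsSub K P w ∧ (∀ z' ∈ K, w z' ≤ u z') ∧ a < w z) :
    IsSub K P (uscEnv K u) := by
  refine ⟨upperSemicontinuousOn_uscEnv hu, fun φ hφ z hz hmax => ?_⟩
  by_contra hnot
  set v := uscEnv K u with hv
  -- Adding the quartic makes the maximum strict and keeps the 2-jet at `z`.
  set χ : Pt N → ℝ := fun w => φ w + quartic z w with hχdef
  have hχ : ContDiff ℝ 2 χ := hφ.add (contDiff_quartic z)
  have hχz : χ z = φ z := by simp [hχdef, quartic_self]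
  rw [← hess_add_eq hφ (contDiff_quartic z) (fderiv_quartic_self z).2,
    ← grad_add_eq hφ (contDiff_quartic z) (fderiv_quartic_self z).1] at hnot
  have hev := hP χ hχ z hz (v z) hnot
  obtain ⟨U, hU, V, hV, hUV⟩ := mem_prod_iff.1 hev
  obtain ⟨r, hr, hrU⟩ := Metric.mem_nhdsWithin_iff.1 hU
  obtain ⟨δ, hδ, hδV⟩ := Metric.mem_nhds_iff.1 hV
  have hcont : ∀ᶠ w in 𝓝 z, |χ w - χ z| < δ / 3 := by
    have := hχ.continuous.continuousAt.eventually
      (Metric.ball_mem_nhds (χ z) (by positivity : 0 < δ / 3))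
    simpa [Real.dist_eq] using this
  obtain ⟨r', hr', hr'c⟩ := Metric.eventually_nhds_iff.1 hcont
  set ρ := min r r' / 2 with hρ
  have hρ0 : 0 < ρ := by positivity
  have hmin0 : 0 < min r r' := by positivity
  have hρr : ρ < r := by linarith [min_le_left r r']
  have hρr' : ρ < r' := by linarith [min_le_right r r']
  set η := min (ρ ^ 4 / 2) (δ / 3) with hη
  have hη0 : 0 < η := by positivity
  have hη1 : η ≤ ρ ^ 4 / 2 := min_le_left _ _
  have hη2 : η ≤ δ / 3 := min_le_right _ _
  have hfreq := frequently_lt_of_lt_uscEnv hu hz (a := v z - η / 2) (by rw [← hv]; linarith)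
  have hcont2 : ∀ᶠ w in 𝓝[K] z, |χ w - χ z| < η / 2 := by
    have := hχ.continuous.continuousAt.eventually
      (Metric.ball_mem_nhds (χ z) (by positivity : 0 < η / 2))
    refine nhdsWithin_le_nhds (this.mono fun w hw => ?_)
    simpa [Real.dist_eq] using hw
  obtain ⟨y, hy, hyc, hyK⟩ := (hfreq.and_eventually (hcont2.and self_mem_nhdsWithin)).exists
  obtain ⟨w, hw, hwu, hyw⟩ := hsup y hyK _ hy
  have hc : UpperSemicontinuousOn (fun x => w x - χ x) K := upperSemicontinuousOn_sub hw.1 hχ.continuous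
  -- The maximum point `m` of `w - χ` is close to `z`, and `w m` is close to `v z`.
  obtain ⟨m, hm, hmmax⟩ := hc.exists_isMaxOn ⟨z, hz⟩ hK
  have h1 : w y - χ y ≤ w m - χ m := hmmax hyK
  have h2 : w m ≤ v m := (hwu m hm).trans (le_uscEnv hu hm)
  have h3 : v m - φ m ≤ v z - φ z := hmax hm
  have h4 : χ m = φ m + quartic z m := rfl
  have hyc' := abs_lt.1 hyc
  have h5 : quartic z m < ρ ^ 4 := by
    have : 0 < ρ ^ 4 := by positivity
    linarith
  have hdist : dist m z < ρ := by
    by_contra! hle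
    exact absurd (pow_le_quartic hρ0.le hle) (not_le.2 h5)
  have hcm := abs_lt.1 (hr'c (hdist.trans hρr'))
  have hq := quartic_nonneg z m
  have hval : w m ∈ Metric.ball (v z) δ := by
    rw [Metric.mem_ball, Real.dist_eq, abs_lt]
    constructor <;> linarith
  exact hUV (⟨hrU ⟨hdist.trans hρr, hm⟩, hδV hval⟩ : (m, w m) ∈ U ×ˢ V) (hw.2 χ hχ m hm hmmax)

/-- Perron's method. The strict inequality `¬ Q` for a `C²` function passes to the inequality `P` for
each test function touching it from above (`hPQ`), so `C²` functions can be used as local bumps. -/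
theorem exists_isSub_isSuper (hK : IsCompact K) (hP : IsClosedAlongJets K P)
    (hQ : IsClosedAlongJets K Q)
    (hPQ : ∀ φ χ : Pt N → ℝ, ContDiff ℝ 2 φ → ContDiff ℝ 2 χ → ∀ z ∈ K,
      IsLocalMaxOn (fun w => φ w - χ w) K z → ¬ Q (hess φ z) (grad φ z) (φ z) z →
        P (hess χ z) (grad χ z) (φ z) z)
    {C : ℝ} (hbdd : ∀ v, IsSub K P v → ∀ z ∈ K, v z ≤ C)
    {φ₀ : Pt N → ℝ} (hφ₀ : ContDiff ℝ 2 φ₀)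
    (hφ₀Q : ∀ z ∈ K, ¬ Q (hess φ₀ z) (grad φ₀ z) (φ₀ z) z) :
    ∃ u, IsBddOn K u ∧ IsSub K P (uscEnv K u) ∧ IsSuper K Q (lscEnv K u) := by
  have hsub₀ : IsSub K P φ₀ := ⟨hφ₀.continuous.continuousOn.upperSemicontinuousOn,
    fun χ hχ z hz hmax => hPQ φ₀ χ hφ₀ hχ z hz hmax.localize (hφ₀Q z hz)⟩
  set A : Pt N → Set ℝ := fun z => {r | ∃ v, IsSub K P v ∧ v z = r} with hA
  set u : Pt N → ℝ := fun z => sSup (A z) with hu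
  have hAb : ∀ z ∈ K, BddAbove (A z) := fun z hz => ⟨C, by
    rintro r ⟨v, hv, rfl⟩; exact hbdd v hv z hz⟩
  have hAne : ∀ z, (A z).Nonempty := fun z => ⟨φ₀ z, φ₀, hsub₀, rfl⟩
  have hle : ∀ v, IsSub K P v → ∀ z ∈ K, v z ≤ u z := fun v hv z hz =>
    le_csSup (hAb z hz) ⟨v, hv, rfl⟩
  have huC : ∀ z ∈ K, u z ≤ C := fun z hz => csSup_le (hAne z) (by
    rintro r ⟨v, hv, rfl⟩; exact hbdd v hv z hz)
  have hub : IsBddOn K u := by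
    obtain ⟨M, hM⟩ := hK.exists_bound_of_continuousOn hφ₀.continuous.continuousOn
    refine ⟨max C M, fun z hz => abs_le.2 ⟨?_, (huC z hz).trans (le_max_left _ _)⟩⟩
    have h1 := (abs_le.1 ((Real.norm_eq_abs _).symm.trans_le (hM z hz))).1
    have h2 := hle φ₀ hsub₀ z hz
    have h3 := le_max_right C M
    linarith
  have husub : IsSub K P (uscEnv K u) := by
    refine isSub_uscEnv hK hP hub fun z hz a ha => ?_
    obtain ⟨_, ⟨v, hv, rfl⟩, hav⟩ := exists_lt_of_lt_csSup (hAne z) ha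
    exact ⟨v, hv, hle v hv, hav⟩
  have hueq : ∀ z ∈ K, uscEnv K u z = u z := fun z hz =>
    le_antisymm (hle _ husub z hz) (le_uscEnv hub hz)
  have huc : UpperSemicontinuousOn u K := fun z hz a ha => by
    have := husub.1 z hz a ((hueq z hz).trans_lt ha)
    filter_upwards [this, self_mem_nhdsWithin] with w hw hwK
    exact (hueq w hwK).symm.trans_lt hw
  refine ⟨u, hub, husub, lowerSemicontinuousOn_lscEnv hub, fun φ hφ z hz hmin => ?_⟩
  by_contra hnot
  set l := lscEnv K u with hl
  -- `χ` touches the lower envelope from below at `z`, strictly elsewhere.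
  set c := l z - φ z with hc
  set q : Pt N → ℝ := fun w => -quartic z w + c with hq
  have hqc : ContDiff ℝ 2 q := (contDiff_quartic z).neg.add contDiff_const
  set χ : Pt N → ℝ := fun w => φ w + q w with hχdef
  have hχ : ContDiff ℝ 2 χ := hφ.add hqc
  have hq1 : fderiv ℝ q = fun w => -fderiv ℝ (quartic z) w := by
    funext w
    rw [hq, fderiv_add_const, fderiv_fun_neg]
  have hχz : χ z = l z := by simp [hχdef, hq, quartic_self, hc]
  have hχle : ∀ w ∈ K, χ w + quartic z w ≤ u w := fun w hw => by
    have h1 : l z - φ z ≤ l w - φ w := hmin hw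
    have h2 : l w ≤ u w := lscEnv_le hub hw
    simp only [hχdef, hq, hc]; linarith
  rw [← hess_add_eq hφ hqc (by rw [hq1, fderiv_fun_neg, (fderiv_quartic_self z).2, neg_zero]),
    ← grad_add_eq hφ hqc (by simp only [hq1, (fderiv_quartic_self z).1, neg_zero])] at hnot
  have hev := hQ χ hχ z hz (l z) hnot
  obtain ⟨U, hU, V, hV, hUV⟩ := mem_prod_iff.1 hev
  obtain ⟨r, hr, hrU⟩ := Metric.mem_nhdsWithin_iff.1 hU
  obtain ⟨δ, hδ, hδV⟩ := Metric.mem_nhds_iff.1 hV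
  have hcont : ∀ᶠ w in 𝓝 z, |χ w - χ z| < δ / 2 := by
    have := hχ.continuous.continuousAt.eventually
      (Metric.ball_mem_nhds (χ z) (by positivity : 0 < δ / 2))
    simpa [Real.dist_eq] using this
  obtain ⟨r', hr', hr'c⟩ := Metric.eventually_nhds_iff.1 hcont
  set ρ := min r r' with hρ
  have hρ0 : 0 < ρ := by positivity
  set η := min ((ρ / 2) ^ 4 / 2) (δ / 2) with hη
  have hη0 : 0 < η := by positivity
  have hη1 : η ≤ (ρ / 2) ^ 4 / 2 := min_le_left _ _
  have hη2 : η ≤ δ / 2 := min_le_right _ _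
  set ψ : Pt N → ℝ := fun w => χ w + η with hψdef
  have hψ : ContDiff ℝ 2 ψ := hχ.add contDiff_const
  have hstrict : ∀ w ∈ K, dist w z < ρ → ¬ Q (hess ψ w) (grad ψ w) (ψ w) w := by
    intro w hw hd
    rw [hess_add_const, grad_add_const]
    refine hUV (⟨hrU ⟨hd.trans_le (min_le_left _ _), hw⟩, hδV ?_⟩ : (w, ψ w) ∈ U ×ˢ V)
    have := abs_lt.1 (hr'c (hd.trans_le (min_le_right _ _)))
    rw [Metric.mem_ball, Real.dist_eq, abs_lt]
    constructor <;> simp only [hψdef] <;> linarith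
  have hfar : ∀ w ∈ K, ρ / 2 ≤ dist w z → ψ w < u w := by
    intro w hw hd
    have h1 := pow_le_quartic (by positivity) hd
    have h2 := hχle w hw
    have : 0 < (ρ / 2) ^ 4 := by positivity
    simp only [hψdef]; linarith
  -- The bump: `ψ` replaces `u` where it is larger, which happens only near `z`.
  set W : Pt N → ℝ := fun w => if dist w z < ρ then max (u w) (ψ w) else u w with hW
  have huW : ∀ w, u w ≤ W w := fun w => by
    simp only [hW]; split_ifs
    exacts [le_max_left _ _, le_rfl]
  have hψW : ∀ w, dist w z < ρ → ψ w ≤ W w := fun w hw => by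
    simp only [hW, if_pos hw]; exact le_max_right _ _
  have hWfar : ∀ w ∈ K, ρ / 2 ≤ dist w z → W w = u w := fun w hw hd => by
    simp only [hW]; split_ifs
    exacts [max_eq_left (hfar w hw hd).le, rfl]
  have hWsub : IsSub K P W := by
    refine ⟨fun w hw a ha => ?_, fun θ hθ w hw hmax => ?_⟩
    · rcases lt_or_ge (dist w z) ρ with hd | hd
      · have h1 := huc w hw a ((huW w).trans_lt ha)
        have h2 : ∀ᶠ x in 𝓝[K] w, ψ x < a := nhdsWithin_le_nhds
          (hψ.continuous.continuousAt.eventually (Iio_mem_nhds ((hψW w hd).trans_lt ha)))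
        filter_upwards [h1, h2] with x hx1 hx2
        simp only [hW]; split_ifs
        exacts [max_lt hx1 hx2, hx1]
      · have h1 := huc w hw a ((huW w).trans_lt ha)
        have h2 : ∀ᶠ x in 𝓝[K] w, ρ / 2 < dist x z := nhdsWithin_le_nhds
          ((continuous_id.dist continuous_const).continuousAt.eventually
            (Ioi_mem_nhds (by simpa using (by linarith : ρ / 2 < dist w z))))
        filter_upwards [h1, h2, self_mem_nhdsWithin] with x hx1 hx2 hxK
        rwa [hWfar x hxK hx2.le]
    · by_cases hWu : W w = u w
      · rw [hWu, ← hueq w hw]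
        refine husub.2 θ hθ w hw fun x hx => ?_
        have h1 : W x - θ x ≤ W w - θ w := hmax hx
        simp only [mem_ofPred_eq]
        rw [hueq x hx, hueq w hw, ← hWu]
        linarith [huW x]
      · have hd : dist w z < ρ := by
          by_contra hd
          exact hWu (by simp only [hW, if_neg hd])
        have hWψ : W w = ψ w := by
          have h1 : W w = max (u w) (ψ w) := by simp only [hW, if_pos hd]
          rcases max_choice (u w) (ψ w) with h | h
          · exact absurd (h1.trans h) hWu
          · exact h1.trans h
        rw [hWψ]
        refine hPQ ψ θ hψ hθ w hw ?_ (hstrict w hw hd)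
        have h2 : ∀ᶠ x in 𝓝[K] w, dist x z < ρ := nhdsWithin_le_nhds
          ((continuous_id.dist continuous_const).continuousAt.eventually
            (Iio_mem_nhds (by simpa using hd)))
        filter_upwards [h2, self_mem_nhdsWithin] with x hx hxK
        have h1 : W x - θ x ≤ W w - θ w := hmax hxK
        rw [hWψ] at h1
        linarith [hψW x hx]
  -- The modified function is a subsolution, hence lies below `u`; this bounds `l z` from below.
  have hlow : l z + η ≤ l z := by
    have h1 : ∀ᶠ x in 𝓝[K] z, ψ x ≤ u x := by
      have h2 : ∀ᶠ x in 𝓝[K] z, dist x z < ρ := nhdsWithin_le_nhds (Metric.ball_mem_nhds z hρ0)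
      filter_upwards [h2, self_mem_nhdsWithin] with x hx hxK
      exact (hψW x hx).trans (hle W hWsub x hxK)
    refine le_of_forall_lt_imp_le_of_dense fun a ha => le_lscEnv hub hz ?_
    have h3 : ∀ᶠ x in 𝓝[K] z, a < ψ x := nhdsWithin_le_nhds
      (hψ.continuous.continuousAt.eventually (Ioi_mem_nhds (by simpa [hψdef, hχz] using ha)))
    filter_upwards [h1, h3] with x hx1 hx3
    exact hx3.le.trans hx1
  linarith

end Perron

/-! ### Mollification -/

section Mollify

set_option maxSynthPendingDepth 3

open MeasureTheory ContinuousLinearMap Convolution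

theorem norm_convolution_sub_le {E F F' : Type*} [NormedAddCommGroup E] [NormedSpace ℝ E]
    [FiniteDimensional ℝ E] [MeasurableSpace E] [BorelSpace E] {μ : Measure E}
    [μ.IsAddHaarMeasure] [NormedAddCommGroup F] [NormedSpace ℝ F] [NormedAddCommGroup F']
    [NormedSpace ℝ F'] (B : F →L[ℝ] ℝ →L[ℝ] F') {h : E → F} (hc : HasCompactSupport h)
    (hh : Continuous h) {f : E → ℝ} {L : NNReal} (hf : LipschitzWith L f) (x x' : E) :
    ‖(h ⋆[B, μ] f) x - (h ⋆[B, μ] f) x'‖ ≤ ‖B‖ * (∫ t, ‖h t‖ ∂μ) * L * ‖x - x'‖ := by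
  have hex := hc.convolutionExists_left B hh (hf.continuous.locallyIntegrable (μ := μ))
  have hI : Integrable (fun t => ‖h t‖) μ := (hh.integrable_of_hasCompactSupport hc).norm
  unfold convolution
  rw [← integral_sub (hex x) (hex x')]
  calc _ ≤ ∫ t, ‖B‖ * ‖h t‖ * (L * ‖x - x'‖) ∂μ := by
        refine norm_integral_le_of_norm_le ((hI.const_mul _).mul_const _) (ae_of_all _ fun t => ?_)
        rw [← map_sub]
        refine (B.le_opNorm₂ _ _).trans ?_
        gcongr
        have := hf.dist_le_mul (x - t) (x' - t)
        simpa [dist_eq_norm] using this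
    _ = _ := by rw [integral_mul_const, integral_const_mul]; ring

theorem exists_contDiff_hasCompactSupport_eqOn {E : Type*} [NormedAddCommGroup E]
    [NormedSpace ℝ E] [FiniteDimensional ℝ E] {n : ℕ∞} {f : E → ℝ}
    (hf : ContDiff ℝ n f) {s : Set (E)} (hs : Bornology.IsBounded s) :
    ∃ g : E → ℝ, ContDiff ℝ n g ∧ HasCompactSupport g ∧ EqOn g f s := by
  obtain ⟨R, hR⟩ := hs.subset_closedBall 0
  let b : ContDiffBump (0 : E) := ⟨max R 1, max R 1 + 1, by positivity, by linarith⟩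
  refine ⟨fun x => b x * f x, b.contDiff.mul hf, b.hasCompactSupport.mul_right, fun x hx => ?_⟩
  have : b x = 1 := b.one_of_mem_closedBall
    (Metric.closedBall_subset_closedBall (le_max_left _ _) (hR hx))
  simp [this]

variable {E : Type*} [NormedAddCommGroup E] [NormedSpace ℝ E] [FiniteDimensional ℝ E]
  [MeasurableSpace E] [BorelSpace E]

/-- Smoothing at unit scale: the second derivative is controlled by the Lipschitz constant alone. -/
theorem exists_smooth_approx_unit : ∃ M : ℝ, 0 ≤ M ∧ ∀ (L : NNReal) (f : E → ℝ),
    LipschitzWith L f → ∃ g : E → ℝ, ContDiff ℝ 2 g ∧ (∀ x, |g x - f x| ≤ L) ∧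
      (∀ x, ‖fderiv ℝ g x‖ ≤ L) ∧ ∀ x, ‖fderiv ℝ (fderiv ℝ g) x‖ ≤ M * L := by
  set μ : Measure E := Measure.addHaar
  let b : ContDiffBump (0 : E) := ⟨1 / 2, 1, by norm_num, by norm_num⟩
  set η : E → ℝ := b.normed μ with hη
  have hηc : HasCompactSupport η := b.hasCompactSupport_normed
  have hηs : ContDiff ℝ 2 η := b.contDiff_normed
  set B := (lsmul ℝ ℝ : ℝ →L[ℝ] ℝ →L[ℝ] ℝ) with hB
  have hd : Continuous (fderiv ℝ η) := hηs.continuous_fderiv (by norm_num)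
  refine ⟨‖B.precompL (E)‖ * ∫ t, ‖fderiv ℝ η t‖ ∂μ, by positivity, fun L f hf => ?_⟩
  have hli : LocallyIntegrable f (μ : Measure (E)) := hf.continuous.locallyIntegrable
  refine ⟨η ⋆[B, μ] f, hηc.contDiff_convolution_left B hηs hli, fun x => ?_, fun x => ?_,
    fun x => ?_⟩
  · rw [← Real.dist_eq]
    refine b.dist_normed_convolution_le hf.continuous.aestronglyMeasurable fun y hy => ?_
    refine (hf.dist_le_mul y x).trans ?_
    have : dist y x ≤ 1 := (Metric.mem_ball.1 hy).le
    nlinarith [L.2]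
  · refine norm_fderiv_le_of_lipschitz ℝ (C := L) (LipschitzWith.of_dist_le_mul fun y z => ?_)
    rw [dist_eq_norm, dist_eq_norm]
    refine (norm_convolution_sub_le B hηc hηs.continuous hf y z).trans ?_
    have h1 : ∫ t, ‖η t‖ ∂μ = 1 := by
      rw [← b.integral_normed (μ := μ)]
      exact integral_congr_ae (ae_of_all _ fun t => Real.norm_of_nonneg (b.nonneg_normed t))
    rw [h1, mul_one]
    have h2 : ‖B‖ ≤ 1 := opNorm_lsmul_le
    have : ‖B‖ * L ≤ 1 * L := mul_le_mul_of_nonneg_right h2 L.2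
    have := mul_le_mul_of_nonneg_right this (norm_nonneg (y - z))
    linarith
  · have hfd : fderiv ℝ (η ⋆[B, μ] f) = fderiv ℝ η ⋆[B.precompL (E), μ] f :=
      funext fun y =>
        (hηc.hasFDerivAt_convolution_left B (hηs.of_le (by norm_num)) hli y).fderiv
    rw [hfd]
    set C : NNReal := ⟨‖B.precompL (E)‖ * ∫ t, ‖fderiv ℝ η t‖ ∂μ, by positivity⟩ with hC
    have := norm_fderiv_le_of_lipschitz ℝ (C := C * L) (x₀ := x)
      (f := fderiv ℝ η ⋆[B.precompL (E), μ] f)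
      (LipschitzWith.of_dist_le_mul fun y z => ?_)
    · rw [NNReal.coe_mul] at this
      exact this
    · rw [dist_eq_norm, dist_eq_norm]
      exact norm_convolution_sub_le (B.precompL (E)) (hηc.fderiv ℝ) hd hf y z

/-- Smoothing at scale `ε`, obtained from unit scale by the rescaling `x ↦ ε⁻¹ f(ε x)`, which keeps
the Lipschitz constant. -/
theorem exists_smooth_approx : ∃ M : ℝ, 0 ≤ M ∧ ∀ (L : NNReal) (f : E → ℝ),
    LipschitzWith L f → ∀ ε : ℝ, 0 < ε → ∃ g : E → ℝ, ContDiff ℝ 2 g ∧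
      (∀ x, |g x - f x| ≤ L * ε) ∧ (∀ x, ‖fderiv ℝ g x‖ ≤ L) ∧
      ∀ x, ε * ‖fderiv ℝ (fderiv ℝ g) x‖ ≤ M * L := by
  obtain ⟨M, hM, h⟩ := exists_smooth_approx_unit (E := E)
  refine ⟨M, hM, fun L f hf ε hε => ?_⟩
  have hsc : LipschitzWith L fun x => ε⁻¹ * f (ε • x) := by
    refine LipschitzWith.of_dist_le_mul fun x y => ?_
    have := hf.dist_le_mul (ε • x) (ε • y)
    rw [dist_smul₀, Real.norm_of_nonneg hε.le] at this
    rw [Real.dist_eq] at this ⊢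
    rw [← mul_sub, abs_mul, abs_of_pos (inv_pos.2 hε), inv_mul_le_iff₀ hε]
    linarith
  obtain ⟨g, hg, h0, h1, h2⟩ := h L _ hsc
  have hg1 : Differentiable ℝ g := hg.differentiable (by norm_num)
  have hd : fderiv ℝ (fun x => ε * g (ε⁻¹ • x)) = fun x => fderiv ℝ g (ε⁻¹ • x) := by
    funext x
    rw [fderiv_const_mul (by fun_prop), fderiv_comp_smul, smul_smul, mul_inv_cancel₀ hε.ne',
      one_smul]
  refine ⟨fun x => ε * g (ε⁻¹ • x), by fun_prop, fun x => ?_, fun x => ?_, fun x => ?_⟩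
  · have := h0 (ε⁻¹ • x)
    rw [smul_smul, mul_inv_cancel₀ hε.ne', one_smul] at this
    have h3 : ε * g (ε⁻¹ • x) - f x = ε * (g (ε⁻¹ • x) - ε⁻¹ * f x) := by field_simp
    rw [h3, abs_mul, abs_of_pos hε]
    nlinarith
  · rw [hd]; exact h1 _
  · rw [hd, fderiv_comp_smul, norm_smul, norm_inv, Real.norm_of_nonneg hε.le, ← mul_assoc,
      mul_inv_cancel₀ hε.ne', one_mul]
    exact h2 _

/-- `C²` approximations at scale `ε` of a `C¹` function, on a bounded set: the error is `O(ε)`, the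
first derivatives are bounded, and the second derivatives are `O(1/ε)`. -/
theorem exists_smooth_approx_of_contDiff {f : E → ℝ} (hf : ContDiff ℝ 1 f)
    {s : Set (E)} (hs : Bornology.IsBounded s) :
    ∃ M : ℝ, 0 ≤ M ∧ ∀ ε : ℝ, 0 < ε → ∃ g : E → ℝ, ContDiff ℝ 2 g ∧
      (∀ x ∈ s, |g x - f x| ≤ M * ε) ∧ (∀ x, ‖fderiv ℝ g x‖ ≤ M) ∧
      ∀ x, ε * ‖fderiv ℝ (fderiv ℝ g) x‖ ≤ M := by
  obtain ⟨h, hh, hhc, hhf⟩ := exists_contDiff_hasCompactSupport_eqOn (n := 1) hf hs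
  obtain ⟨L, hL⟩ := ContDiff.lipschitzWith_of_hasCompactSupport hhc hh (by norm_num)
  obtain ⟨M, hM, H⟩ := exists_smooth_approx (E := E)
  refine ⟨max (L : ℝ) (M * L), le_max_of_le_left L.2, fun ε hε => ?_⟩
  obtain ⟨g, hg, h0, h1, h2⟩ := H L h hL ε hε
  refine ⟨g, hg, fun x hx => ?_, fun x => (h1 x).trans (le_max_left _ _),
    fun x => (h2 x).trans (le_max_right _ _)⟩
  rw [← hhf hx]
  exact (h0 x).trans (mul_le_mul_of_nonneg_right (le_max_left _ _) hε.le)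

theorem exists_contDiff_fderiv_near {ρ : E → ℝ} (hρ : ContDiff ℝ 1 ρ)
    (hc : HasCompactSupport ρ) {δ : ℝ} (hδ : 0 < δ) :
    ∃ ψ : E → ℝ, ContDiff ℝ 3 ψ ∧ ∀ x, ‖fderiv ℝ ψ x - fderiv ℝ ρ x‖ ≤ δ := by
  have hd : Continuous (fderiv ℝ ρ) := hρ.continuous_fderiv one_ne_zero
  have hu : UniformContinuous (fderiv ℝ ρ) :=
    (hc.fderiv ℝ).uniformContinuous_of_continuous hd
  obtain ⟨r, hr, hru⟩ := Metric.uniformContinuous_iff.1 hu δ hδ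
  set μ : Measure E := Measure.addHaar
  let b : ContDiffBump (0 : E) := ⟨r / 2, r, by positivity, by linarith⟩
  set η : E → ℝ := b.normed μ with hη
  have hηc : HasCompactSupport η := b.hasCompactSupport_normed
  have hηs : ContDiff ℝ 3 η := b.contDiff_normed
  set B := (lsmul ℝ ℝ : ℝ →L[ℝ] ℝ →L[ℝ] ℝ) with hB
  have hli : LocallyIntegrable ρ (μ : Measure (E)) := hρ.continuous.locallyIntegrable
  have hηi : LocallyIntegrable η (μ : Measure (E)) := hηs.continuous.locallyIntegrable
  refine ⟨η ⋆[B, μ] ρ, hηc.contDiff_convolution_left B hηs hli, fun x => ?_⟩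
  rw [(hc.hasFDerivAt_convolution_right B hηi hρ x).fderiv, ← dist_eq_norm]
  have := b.dist_normed_convolution_le (μ := μ) (x₀ := x) (g := fderiv ℝ ρ) (ε := δ)
    hd.aestronglyMeasurable fun y hy => (hru (Metric.mem_ball.1 hy)).le
  have e : (η ⋆[B.precompR E, μ] fderiv ℝ ρ) x = (b.normed μ ⋆[lsmul ℝ ℝ, μ] fderiv ℝ ρ) x := by
    unfold convolution
    refine integral_congr_ae (ae_of_all _ fun t => ?_)
    ext v
    simp [hB, hη]
  rw [e]
  exact this

end Mollify

/-! ### A global defining function for the oblique direction -/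

theorem IsLocalDefiningFunction.eventually {N : ℕ} {Ω : Set (Base N)} {x : Base N}
    {ρ : Base N → ℝ} (h : IsLocalDefiningFunction Ω x ρ) :
    ∀ᶠ z in 𝓝 x, IsLocalDefiningFunction Ω z ρ := by
  obtain ⟨h1, h2, h3⟩ := h
  have hc : ContinuousAt (gradient ρ) x := by
    have : ContinuousAt (fderiv ℝ ρ) x :=
      (h1.fderiv_right (m := 0) (by norm_num)).continuousAt
    exact (InnerProductSpace.toDual ℝ (Base N)).symm.continuous.continuousAt.comp this
  filter_upwards [h1.eventually (by simp), hc.eventually_ne h2, eventually_eventually_nhds.2 h3]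
    with z h1 h2 h3 using ⟨h1, h2, h3⟩

theorem IsLocalDefiningFunction.eq_zero {N : ℕ} {Ω : Set (Base N)} (hΩ : IsOpen Ω) {x : Base N}
    {ρ : Base N → ℝ} (h : IsLocalDefiningFunction Ω x ρ) (hx : x ∈ frontier Ω) : ρ x = 0 := by
  obtain ⟨h1, -, h3⟩ := h
  rw [hΩ.frontier_eq] at hx
  have h0 : ¬ ρ x < 0 := fun hlt => hx.2 (h3.self_of_nhds.2 hlt)
  refine le_antisymm ?_ (not_lt.1 h0)
  by_contra! hpos
  have hev : ∀ᶠ z in 𝓝 x, 0 < ρ z := h1.continuousAt.eventually (Ioi_mem_nhds hpos)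
  obtain ⟨z, hzΩ, hz1, hz2⟩ :=
    ((mem_closure_iff_frequently.1 hx.1).and_eventually (h3.and hev)).exists
  exact absurd (hz1.1 hzΩ) (not_lt.2 hz2.le)

theorem IsLocalDefiningFunction.fderiv_pos {N : ℕ} {Ω : Set (Base N)} {x : Base N}
    {ρ : Base N → ℝ} (h : IsLocalDefiningFunction Ω x ρ) {v : Base N}
    (hv : ∀ n, IsOutwardUnitNormal Ω x n → 0 < inner ℝ v n) : 0 < fderiv ℝ ρ x v := by
  have h1 := hv _ ⟨ρ, h, rfl⟩
  rw [inner_smul_right] at h1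
  have h2 := pos_of_mul_pos_right h1 (inv_nonneg.2 (norm_nonneg _))
  rwa [real_inner_comm, gradient, InnerProductSpace.toDual_symm_apply] at h2

/-- Local defining functions, glued with bump functions, give a `C¹` function `ρ` that vanishes on
`∂Ω`, is negative only inside `Ω` near `∂Ω`, and increases in each direction with positive normal
component. No partition of unity is needed, because the local functions vanish on `∂Ω`. -/
theorem exists_global_defining {N : ℕ} {Ω : Set (Base N)} (hΩ : IsOpen Ω)
    (hb : Bornology.IsBounded Ω) (h1 : HasC1Boundary Ω) :
    ∃ ρ : Base N → ℝ, ContDiff ℝ 1 ρ ∧ HasCompactSupport ρ ∧ ∀ x ∈ frontier Ω,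
      ρ x = 0 ∧ (∀ᶠ z in 𝓝 x, ρ z < 0 → z ∈ Ω) ∧
      ∀ v, (∀ n, IsOutwardUnitNormal Ω x n → 0 < inner ℝ v n) → 0 < fderiv ℝ ρ x v := by
  classical
  have hcomp : IsCompact (frontier Ω) :=
    Metric.isCompact_of_isClosed_isBounded isClosed_frontier
      (hb.closure.subset frontier_subset_closure)
  have hloc : ∀ x ∈ frontier Ω, ∃ ρ : Base N → ℝ, ∃ r : ℝ, 0 < r ∧
      ∀ z ∈ Metric.ball x r, IsLocalDefiningFunction Ω z ρ := by
    intro x hx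
    obtain ⟨ρ, hρ⟩ := h1 x hx
    obtain ⟨r, hr, h⟩ := Metric.eventually_nhds_iff_ball.1 hρ.eventually
    exact ⟨ρ, r, hr, h⟩
  choose! σ r hr hσ using hloc
  obtain ⟨t, htf, htc⟩ := hcomp.elim_nhds_subcover (fun x => Metric.ball x (r x / 3))
    (fun x hx => Metric.ball_mem_nhds x (by linarith [hr x hx]))
  have hbump : ∀ x, ∃ b : ContDiffBump x, x ∈ frontier Ω → b.rIn = r x / 3 ∧ b.rOut = r x / 2 := by
    intro x
    by_cases hx : x ∈ frontier Ω
    · have := hr x hx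
      exact ⟨⟨r x / 3, r x / 2, by linarith, by linarith⟩, fun _ => ⟨rfl, rfl⟩⟩
    · exact ⟨⟨1, 2, by norm_num, by norm_num⟩, fun h => absurd h hx⟩
  choose b hb' using hbump
  set τ : Base N → Base N → ℝ := fun i z => b i z * σ i z with hτ
  -- each summand vanishes identically near points outside the ball where `σ i` is controlled
  have hzero : ∀ i ∈ t, ∀ x, x ∉ Metric.ball i (r i) → ∀ᶠ z in 𝓝 x, τ i z = 0 := by
    intro i hi x hx
    have hri := hr i (htf i hi)
    have : ∀ᶠ z in 𝓝 x, r i / 2 < dist z i :=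
      (continuous_id.dist continuous_const).continuousAt.eventually (Ioi_mem_nhds
        (by simp only [Metric.mem_ball, not_lt] at hx; simpa using (by linarith)))
    filter_upwards [this] with z hz
    simp only [hτ]
    rw [(b i).zero_of_le_dist (by rw [(hb' i (htf i hi)).2]; exact hz.le), zero_mul]
  have hsmooth : ∀ i ∈ t, ContDiff ℝ 1 (τ i) := by
    intro i hi
    rw [contDiff_iff_contDiffAt]
    intro x
    by_cases hx : x ∈ Metric.ball i (r i)
    · exact (b i).contDiff.contDiffAt.mul (hσ i (htf i hi) x hx).1
    · exact contDiffAt_const.congr_of_eventuallyEq (hzero i hi x hx)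
  have hder : ∀ i ∈ t, ∀ x ∈ frontier Ω, x ∈ Metric.ball i (r i) →
      fderiv ℝ (τ i) x = b i x • fderiv ℝ (σ i) x := by
    intro i hi x hxf hx
    have hl := hσ i (htf i hi) x hx
    simp only [hτ]
    rw [fderiv_fun_mul ((b i).contDiff (n := 1) |>.differentiable one_ne_zero x)
      (hl.1.differentiableAt one_ne_zero), hl.eq_zero hΩ hxf, zero_smul, add_zero]
  refine ⟨fun z => ∑ i ∈ t, τ i z, ContDiff.sum hsmooth, ?_, fun x hx => ⟨?_, ?_, fun v hv => ?_⟩⟩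
  · refine HasCompactSupport.of_support_subset_isCompact
      (t.isCompact_biUnion (f := fun i => tsupport (b i)) fun i _ => (b i).hasCompactSupport) ?_
    intro z hz
    obtain ⟨i, hi, hne⟩ := Finset.exists_ne_zero_of_sum_ne_zero hz
    exact mem_biUnion hi (subset_tsupport _ (left_ne_zero_of_mul hne))
  · refine Finset.sum_eq_zero fun i hi => ?_
    by_cases hxi : x ∈ Metric.ball i (r i)
    · simp [hτ, (hσ i (htf i hi) x hxi).eq_zero hΩ hx]
    · exact (hzero i hi x hxi).self_of_nhds
  · have hall : ∀ᶠ z in 𝓝 x, ∀ i ∈ t, z ∉ Ω → 0 ≤ τ i z := by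
      refine (eventually_all_finset t).2 fun i hi => ?_
      by_cases hxi : x ∈ Metric.ball i (r i)
      · filter_upwards [(hσ i (htf i hi) x hxi).2.2] with z hz hzΩ
        exact mul_nonneg (b i).nonneg (not_lt.1 fun h => hzΩ (hz.2 h))
      · filter_upwards [hzero i hi x hxi] with z hz _ using hz.ge
    filter_upwards [hall] with z hz hneg
    by_contra hzΩ
    exact absurd hneg (not_lt.2 (Finset.sum_nonneg fun i hi => hz i hi hzΩ))
  · rw [fderiv_fun_sum fun i hi => (hsmooth i hi).differentiable one_ne_zero x, sum_apply]
    refine Finset.sum_pos' (fun i hi => ?_) ?_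
    · by_cases hxi : x ∈ Metric.ball i (r i)
      · rw [hder i hi x hx hxi]
        exact mul_nonneg (b i).nonneg ((hσ i (htf i hi) x hxi).fderiv_pos hv).le
      · have he : fderiv ℝ (τ i) x = 0 := by
          rw [Filter.EventuallyEq.fderiv_eq (f := fun _ => (0 : ℝ)) (hzero i hi x hxi)]; simp
        simp [he]
    · obtain ⟨i, hi, hxi⟩ := mem_iUnion₂.1 (htc hx)
      have hri := hr i (htf i hi)
      have hxi' : x ∈ Metric.ball i (r i) := Metric.ball_subset_ball (by linarith) hxi
      refine ⟨i, hi, ?_⟩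
      rw [hder i hi x hx hxi', (b i).one_of_mem_closedBall, one_smul]
      · exact (hσ i (htf i hi) x hxi').fderiv_pos hv
      · rw [(hb' i (htf i hi)).1]; exact Metric.ball_subset_closedBall hxi

/-- The oblique vector field `γ₁` has a uniformly positive derivative on a defining function `ρ`, and
a smooth function `ψ` increases along it at unit rate. -/
theorem exists_defining_and_smooth {N : ℕ} {Ω : Set (Base N)} (hΩ : IsOpen Ω)
    (hb : Bornology.IsBounded Ω) (h1 : HasC1Boundary Ω) {γ : Pt N → Pt N}
    (hγ : ContinuousOn γ (lateralDataDomain Ω))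
    (hpos : ∀ x ∈ frontier Ω, ∀ n, IsOutwardUnitNormal Ω x n → ∀ y ∈ Icc (-1 : ℝ) 1,
        0 < inner ℝ (γ (x, y)).1 n) :
    ∃ ρ : Base N → ℝ, ∃ κ : ℝ, ∃ ψ : Base N → ℝ, ContDiff ℝ 1 ρ ∧ 0 < κ ∧ ContDiff ℝ 3 ψ ∧
      (∀ x ∈ frontier Ω, ρ x = 0 ∧ ∀ᶠ z in 𝓝 x, ρ z < 0 → z ∈ Ω) ∧
      (∀ z ∈ lateralDataDomain Ω, κ ≤ fderiv ℝ ρ z.1 (γ z).1) ∧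
      ∀ z ∈ lateralDataDomain Ω, 1 ≤ fderiv ℝ ψ z.1 (γ z).1 := by
  obtain ⟨ρ, hρ, hρc, hρf⟩ := exists_global_defining hΩ hb h1
  have hK : IsCompact (lateralDataDomain Ω) :=
    (Metric.isCompact_of_isClosed_isBounded isClosed_frontier
      (hb.closure.subset frontier_subset_closure)).prod isCompact_Icc
  have hd : Continuous (fderiv ℝ ρ) := hρ.continuous_fderiv one_ne_zero
  have hcont : ContinuousOn (fun z : Pt N => fderiv ℝ ρ z.1 (γ z).1) (lateralDataDomain Ω) :=
    (hd.comp continuous_fst).continuousOn.clm_apply (continuous_fst.comp_continuousOn hγ)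
  obtain ⟨κ, hκ, hκle⟩ : ∃ κ : ℝ, 0 < κ ∧
      ∀ z ∈ lateralDataDomain Ω, κ ≤ fderiv ℝ ρ z.1 (γ z).1 := by
    rcases (lateralDataDomain Ω).eq_empty_or_nonempty with he | hne
    · exact ⟨1, one_pos, by simp [he]⟩
    · obtain ⟨z, hz, hmin⟩ := hK.exists_isMinOn hne hcont
      exact ⟨_, (hρf z.1 hz.1).2.2 _ fun n hn => hpos z.1 hz.1 n hn z.2 hz.2, fun w hw => hmin hw⟩
  obtain ⟨G, hG⟩ := hK.exists_bound_of_continuousOn hγ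
  set G' := max G 1
  have hG' : 0 < G' := by positivity
  obtain ⟨ψ, hψ, hψρ⟩ := exists_contDiff_fderiv_near hρ hρc (δ := κ / (2 * G')) (by positivity)
  refine ⟨ρ, κ, fun x => (2 / κ) * ψ x, hρ, hκ, contDiff_const.mul hψ,
    fun x hx => ⟨(hρf x hx).1, (hρf x hx).2.1⟩, hκle, fun z hz => ?_⟩
  rw [fderiv_const_mul (hψ.differentiable (by norm_num) _), smul_apply, smul_eq_mul]
  have h2 : ‖(γ z).1‖ ≤ G' := (norm_fst_le _).trans ((hG z hz).trans (le_max_left _ _))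
  have h3 := (fderiv ℝ ψ z.1 - fderiv ℝ ρ z.1).le_of_opNorm_le_of_le (hψρ z.1) h2
  rw [sub_apply, Real.norm_eq_abs] at h3
  have h4 : κ / (2 * G') * G' = κ / 2 := by field_simp
  have h5 := (abs_le.1 (h3.trans_eq h4)).1
  have h6 : κ / 2 ≤ fderiv ℝ ψ z.1 (γ z).1 := by linarith [hκle z hz]
  calc (1 : ℝ) = 2 / κ * (κ / 2) := by field_simp
    _ ≤ _ := mul_le_mul_of_nonneg_left h6 (by positivity)

/-! ### Uniform bounds on the data -/

/-- The closed region between the graphs of `ε g⁻` and `ε g⁺` over `closure Ω`. -/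
def slab {N : ℕ} (Ω : Set (Base N)) (gm gp : Base N → ℝ) (ε : ℝ) : Set (Pt N) :=
  {z | z.1 ∈ closure Ω ∧ ε * gm z.1 ≤ z.2 ∧ z.2 ≤ ε * gp z.1}

/-- `f(x, y) = f₀(x) + O(|y|)` near `y = 0`, uniformly for `x ∈ closure Ω`. -/
def HasLinearDeviation {N : ℕ} {G : Type*} [NormedAddCommGroup G]
    (Ω : Set (Base N)) (f : Pt N → G) (f₀ : Base N → G) : Prop :=
  ∃ M δ : ℝ, 0 < δ ∧ ∀ x ∈ closure Ω, ∀ y ∈ Icc (-1 : ℝ) 1, |y| < δ →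
    ‖f (x, y) - f₀ x‖ ≤ M * |y|

theorem HasUniformExpansion.hasLinearDeviation {N : ℕ} {G : Type*} [NormedAddCommGroup G]
    [NormedSpace ℝ G] {Ω : Set (Base N)} {f : Pt N → G} {f₀ f₁ : Base N → G}
    (h : HasUniformExpansion Ω f f₀ f₁) (hΩ : IsCompact (closure Ω))
    (h₁ : ContinuousOn f₁ (closure Ω)) : HasLinearDeviation Ω f f₀ := by
  obtain ⟨M, hM⟩ := hΩ.exists_bound_of_continuousOn h₁
  obtain ⟨δ, hδ, hf⟩ := h 1 one_pos
  refine ⟨1 + M, δ, hδ, fun x hx y hy hyδ => ?_⟩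
  have h1 := hf x hx y hy hyδ
  have h2 : ‖y • f₁ x‖ ≤ |y| * M := by
    rw [norm_smul, Real.norm_eq_abs]
    exact mul_le_mul_of_nonneg_left (hM x hx) (abs_nonneg y)
  calc ‖f (x, y) - f₀ x‖ = ‖(f (x, y) - (f₀ x + y • f₁ x)) + y • f₁ x‖ := by congr 1; abel
    _ ≤ 1 * |y| + |y| * M := (norm_add_le _ _).trans (add_le_add h1 h2)
    _ = (1 + M) * |y| := by ring

theorem HasLinearDeviation.neg {N : ℕ} {Ω : Set (Base N)} {f : Pt N → ℝ} {f₀ : Base N → ℝ}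
    (h : HasLinearDeviation Ω f f₀) :
    HasLinearDeviation Ω (fun z => -f z) (fun x => -f₀ x) := by
  obtain ⟨M, δ, hδ, hf⟩ := h
  refine ⟨M, δ, hδ, fun x hx y hy hyδ => ?_⟩
  rw [neg_sub_neg, norm_sub_rev]
  exact hf x hx y hy hyδ

theorem eventually_mul_lt {c d : ℝ} (hd : 0 < d) : ∀ᶠ ε : ℝ in 𝓝[>] 0, c * ε < d := by
  have : Tendsto (fun ε : ℝ => c * ε) (𝓝 0) (𝓝 0) := by
    simpa using (continuous_const.mul continuous_id).tendsto (0 : ℝ) (f := fun ε : ℝ => c * ε)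
  exact nhdsWithin_le_nhds (this.eventually (Iio_mem_nhds hd))

/-- A continuous function on `s × [-1, 1]`, with `s` compact, that vanishes at height `0` is
uniformly small at small heights. -/
theorem eventually_small_of_eq_zero {N : ℕ} {s : Set (Base N)} (hs : IsCompact s) {f : Pt N → ℝ}
    (hf : ContinuousOn f (s ×ˢ Icc (-1 : ℝ) 1)) (h0 : ∀ x ∈ s, f (x, 0) = 0) {η : ℝ}
    (hη : 0 < η) :
    ∃ δ : ℝ, 0 < δ ∧ ∀ z ∈ s ×ˢ Icc (-1 : ℝ) 1, |z.2| < δ → |f z| < η := by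
  have hu := (hs.prod isCompact_Icc).uniformContinuousOn_of_continuous hf
  obtain ⟨δ, hδ, h⟩ := Metric.uniformContinuousOn_iff.1 hu η hη
  refine ⟨δ, hδ, fun z hz hzδ => ?_⟩
  have := h z hz (z.1, 0) ⟨hz.1, by norm_num⟩ (by
    rw [Prod.dist_eq]; simpa [Real.dist_eq] using hzδ)
  rwa [h0 z.1 hz.1, dist_zero_right, Real.norm_eq_abs] at this

/-- On jets bounded by `R`, the operator is bounded below, uniformly over the domain of the data, by
an affine function of the value with positive slope. -/
theorem IsProperElliptic.exists_lower_bound {N : ℕ} {Ω : Set (Base N)}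
    {F : Mat N → Pt N → ℝ → Pt N → ℝ} (hF : IsProperElliptic Ω F)
    (hb : Bornology.IsBounded Ω) (R : ℝ) :
    ∃ r₀ : ℝ, ∀ X : Mat N, X.IsSymm → (∀ i j, |X i j| ≤ R) → ∀ p : Pt N, ‖p‖ ≤ R →
      ∀ z ∈ dataDomain Ω, ∀ r, r₀ ≤ r → 0 < F X p r z := by
  obtain ⟨hc, α, hα, hmono⟩ := hF
  set J : Set (Mat N) := {X | X.IsSymm} ∩ {X | ∀ i j, X i j ∈ Icc (-R) R} with hJ
  have hJc : IsCompact J := by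
    refine IsCompact.inter_left ?_ ?_
    · have : {X : Mat N | ∀ i j, X i j ∈ Icc (-R) R}
          = Set.pi univ fun _ => Set.pi univ fun _ => Icc (-R) R := by
        ext X; exact ⟨fun h i _ j _ => h i j, fun h i j => h i trivial j trivial⟩
      rw [this]
      exact isCompact_univ_pi fun _ => isCompact_univ_pi fun _ => isCompact_Icc
    · exact isClosed_eq (continuous_id.matrix_transpose) continuous_id
  have hD : IsCompact (dataDomain Ω) := hb.isCompact_closure.prod isCompact_Icc
  have hK : IsCompact (J ×ˢ (Metric.closedBall (0 : Pt N) R ×ˢ (({0} : Set ℝ) ×ˢ dataDomain Ω))) :=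
    hJc.prod ((isCompact_closedBall _ _).prod (isCompact_singleton.prod hD))
  obtain ⟨Λ, hΛ⟩ := hK.exists_bound_of_continuousOn (hc.mono (by
    rintro ⟨X, p, r, z⟩ ⟨hX, -, -, hz⟩
    exact ⟨hX.1, hz⟩))
  refine ⟨(|Λ| + 1) / α, fun X hX hXR p hp z hz r hr => ?_⟩
  have h1 : ‖F X p 0 z‖ ≤ Λ := hΛ (X, p, 0, z)
    ⟨⟨hX, fun i j => abs_le.1 (hXR i j)⟩, by simpa using hp, rfl, hz⟩
  have h2 := hmono p z hz X X hX hX (by simpa using Matrix.PosSemidef.zero) 0 r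
    (le_trans (by positivity) hr)
  have h3 : |Λ| + 1 ≤ α * r := by rwa [div_le_iff₀ hα, mul_comm] at hr
  have h4 := (abs_le.1 ((Real.norm_eq_abs _).symm.trans_le h1)).1
  have := le_abs_self Λ
  linarith

/-! ### The barrier -/

/-- The ansatz `ψ(x) + y f(x) + (A/2) (y - ε m(x))²` for a strict supersolution. -/
def ansatz {N : ℕ} (ψ f m : Base N → ℝ) (A ε : ℝ) (z : Pt N) : ℝ :=
  ψ z.1 + z.2 * f z.1 + A / 2 * (z.2 - ε * m z.1) ^ 2

section Ansatz

variable {N : ℕ} {ψ f m : Base N → ℝ} {A ε : ℝ}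

theorem contDiff_ansatz (hψ : ContDiff ℝ 2 ψ) (hf : ContDiff ℝ 2 f) (hm : ContDiff ℝ 2 m) :
    ContDiff ℝ 2 (ansatz ψ f m A ε) := by
  unfold ansatz
  fun_prop

theorem hasFDerivAt_comp_fst {G : Type*} [NormedAddCommGroup G] [NormedSpace ℝ G]
    {h : Base N → G} (hh : Differentiable ℝ h) (z : Pt N) :
    HasFDerivAt (fun w : Pt N => h w.1)
      ((fderiv ℝ h z.1).comp (ContinuousLinearMap.fst ℝ (Base N) ℝ)) z :=
  (hh z.1).hasFDerivAt.comp z hasFDerivAt_fst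

theorem fderiv_ansatz (hψ : ContDiff ℝ 2 ψ) (hf : ContDiff ℝ 2 f) (hm : ContDiff ℝ 2 m)
    (z d : Pt N) : fderiv ℝ (ansatz ψ f m A ε) z d = fderiv ℝ ψ z.1 d.1 + d.2 * f z.1
      + z.2 * fderiv ℝ f z.1 d.1
      + A * (z.2 - ε * m z.1) * (d.2 - ε * fderiv ℝ m z.1 d.1) := by
  have h1 := hasFDerivAt_comp_fst (hψ.differentiable (by norm_num)) z
  have h2 := hasFDerivAt_comp_fst (hf.differentiable (by norm_num)) z
  have h3 := hasFDerivAt_comp_fst (hm.differentiable (by norm_num)) z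
  have h4 : HasFDerivAt (fun w : Pt N => w.2) (ContinuousLinearMap.snd ℝ (Base N) ℝ) z :=
    hasFDerivAt_snd
  have h := (h1.add (h4.mul h2)).add (((h4.sub (h3.const_mul ε)).pow 2).const_mul (A / 2))
  have e : fderiv ℝ (ansatz ψ f m A ε) z = _ := HasFDerivAt.fderiv h
  rw [e]
  simp
  ring

theorem fderiv_fderiv_ansatz (hψ : ContDiff ℝ 2 ψ) (hf : ContDiff ℝ 2 f) (hm : ContDiff ℝ 2 m)
    (z d e : Pt N) : fderiv ℝ (fderiv ℝ (ansatz ψ f m A ε)) z e d =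
      fderiv ℝ (fderiv ℝ ψ) z.1 e.1 d.1 + d.2 * fderiv ℝ f z.1 e.1 + e.2 * fderiv ℝ f z.1 d.1
      + z.2 * fderiv ℝ (fderiv ℝ f) z.1 e.1 d.1
      + A * (e.2 - ε * fderiv ℝ m z.1 e.1) * (d.2 - ε * fderiv ℝ m z.1 d.1)
      - A * (z.2 - ε * m z.1) * (ε * fderiv ℝ (fderiv ℝ m) z.1 e.1 d.1) := by
  have hd : ∀ {h : Base N → ℝ}, ContDiff ℝ 2 h → Differentiable ℝ fun x => fderiv ℝ h x d.1 :=
    fun {h} hh => ((hh.fderiv_right (m := 1) (by norm_num)).differentiable one_ne_zero).clm_apply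
      (differentiable_const _)
  have hd' : ∀ {h : Base N → ℝ}, ContDiff ℝ 2 h → ∀ x v,
      fderiv ℝ (fun x => fderiv ℝ h x d.1) x v = fderiv ℝ (fderiv ℝ h) x v d.1 := by
    intro h hh x v
    rw [fderiv_clm_apply ((hh.fderiv_right (m := 1) (by norm_num)).differentiable one_ne_zero x)
      (differentiableAt_const _)]
    simp
  have h0 : fderiv ℝ (fderiv ℝ (ansatz ψ f m A ε)) z e d
      = fderiv ℝ (fun w => fderiv ℝ (ansatz ψ f m A ε) w d) z e := by
    rw [fderiv_clm_apply ((contDiff_one_fderiv (contDiff_ansatz hψ hf hm)).differentiable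
      one_ne_zero z) (differentiableAt_const _)]
    simp
  have h1 := hasFDerivAt_comp_fst (hd hψ) z
  have h2 := hasFDerivAt_comp_fst (hf.differentiable (by norm_num)) z
  have h2' := hasFDerivAt_comp_fst (hd hf) z
  have h3 := hasFDerivAt_comp_fst (hm.differentiable (by norm_num)) z
  have h3' := hasFDerivAt_comp_fst (hd hm) z
  have h4 : HasFDerivAt (fun w : Pt N => w.2) (ContinuousLinearMap.snd ℝ (Base N) ℝ) z :=
    hasFDerivAt_snd
  have h := ((h1.add (h2.const_mul d.2)).add (h4.mul h2')).add
    (((h4.sub (h3.const_mul ε)).const_mul A).mul ((h3'.const_mul ε).const_sub d.2))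
  have e1 : (fun w => fderiv ℝ (ansatz ψ f m A ε) w d) = _ :=
    funext fun w => fderiv_ansatz hψ hf hm w d
  have e2 : fderiv ℝ (fun w : Pt N => fderiv ℝ ψ w.1 d.1 + d.2 * f w.1
      + w.2 * fderiv ℝ f w.1 d.1
      + A * (w.2 - ε * m w.1) * (d.2 - ε * fderiv ℝ m w.1 d.1)) z = _ := HasFDerivAt.fderiv h
  rw [h0, e1, e2]
  simp [hd' hψ, hd' hf, hd' hm]
  ring

end Ansatz

/-- The bounds at `x` satisfied by a mollification at scale `ε` of a `C¹` function. -/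
def JetBound {N : ℕ} (f : Base N → ℝ) (x : Base N) (ε M : ℝ) : Prop :=
  |f x| ≤ M ∧ ‖fderiv ℝ f x‖ ≤ M ∧ ε * ‖fderiv ℝ (fderiv ℝ f) x‖ ≤ M

theorem abs_mul_le_mul {a b p q : ℝ} (ha : |a| ≤ p) (hb : |b| ≤ q) : |a * b| ≤ p * q := by
  rw [abs_mul]
  exact mul_le_mul ha hb (abs_nonneg _) ((abs_nonneg _).trans ha)

theorem abs_apply_le {E : Type*} [NormedAddCommGroup E] [NormedSpace ℝ E] {D : E →L[ℝ] ℝ} {v : E}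
    {M r : ℝ} (hD : ‖D‖ ≤ M) (hv : ‖v‖ ≤ r) : |D v| ≤ M * r := by
  simpa using D.le_of_opNorm_le_of_le hD hv

theorem abs_apply₂_le {E : Type*} [NormedAddCommGroup E] [NormedSpace ℝ E]
    {D : E →L[ℝ] E →L[ℝ] ℝ} {v w : E} {ε M : ℝ} (hε : 0 ≤ ε) (hD : ε * ‖D‖ ≤ M) (hv : ‖v‖ ≤ 1)
    (hw : ‖w‖ ≤ 1) : |ε * D v w| ≤ M := by
  rw [abs_mul, abs_of_nonneg hε]
  refine le_trans (mul_le_mul_of_nonneg_left ?_ hε) hD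
  have h1 : |D v w| ≤ ‖D‖ * ‖v‖ * ‖w‖ := by simpa using D.le_opNorm₂ v w
  have h2 : ‖D‖ * ‖v‖ ≤ ‖D‖ * 1 := mul_le_mul_of_nonneg_left hv D.opNorm_nonneg
  have h3 : ‖D‖ * ‖v‖ * ‖w‖ ≤ ‖D‖ * 1 * 1 :=
    mul_le_mul h2 hw (norm_nonneg _) (mul_nonneg D.opNorm_nonneg zero_le_one)
  linarith

section Estimates

variable {N : ℕ} {ψ f m : Base N → ℝ} {A ε M G Ψ : ℝ} {z : Pt N}

theorem abs_sub_mul_le (hε : 0 < ε) (hz : |z.2| ≤ ε * G) (hm : JetBound m z.1 ε M) :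
    |z.2 - ε * m z.1| ≤ ε * (G + M) := by
  have : |ε * m z.1| ≤ ε * M := by
    rw [abs_mul, abs_of_pos hε]; exact mul_le_mul_of_nonneg_left hm.1 hε.le
  calc |z.2 - ε * m z.1| ≤ |z.2| + |ε * m z.1| := abs_sub _ _
    _ ≤ ε * (G + M) := by linarith

theorem abs_sub_fderiv_le {d : Pt N} (hε : 0 < ε) (hε1 : ε ≤ 1) (hm : JetBound m z.1 ε M)
    {Γ : ℝ} (hd : ‖d‖ ≤ Γ) : |d.2 - ε * fderiv ℝ m z.1 d.1| ≤ (1 + M) * Γ := by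
  have h1 : |fderiv ℝ m z.1 d.1| ≤ M * Γ := abs_apply_le hm.2.1 ((norm_fst_le d).trans hd)
  have h2 : |d.2| ≤ Γ := (norm_snd_le d).trans hd
  have h3 : |ε * fderiv ℝ m z.1 d.1| ≤ 1 * (M * Γ) :=
    abs_mul_le_mul (by rwa [abs_of_pos hε]) h1
  calc _ ≤ |d.2| + |ε * fderiv ℝ m z.1 d.1| := abs_sub _ _
    _ ≤ (1 + M) * Γ := by linarith

/-- The scale `ε` of the mollification is exactly the height of the slab, so the `2`-jets of the
ansatz stay bounded as `ε → 0`. -/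
theorem ansatz_jet_le (hψ : ContDiff ℝ 2 ψ) (hf : ContDiff ℝ 2 f) (hm : ContDiff ℝ 2 m)
    (hA : 0 ≤ A) (hε : 0 < ε) (hε1 : ε ≤ 1) (hG : 0 ≤ G) (hz : |z.2| ≤ ε * G)
    (hψb : JetBound ψ z.1 1 Ψ) (hfb : JetBound f z.1 ε M) (hmb : JetBound m z.1 ε M) :
    |ansatz ψ f m A ε z| ≤ Ψ + G * M + A / 2 * (G + M) ^ 2 ∧
    (∀ d : Pt N, ‖d‖ ≤ 1 →
      |fderiv ℝ (ansatz ψ f m A ε) z d| ≤ Ψ + M + G * M + A * (G + M) * (1 + M)) ∧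
    ∀ e d : Pt N, ‖e‖ ≤ 1 → ‖d‖ ≤ 1 → |fderiv ℝ (fderiv ℝ (ansatz ψ f m A ε)) z e d| ≤
      Ψ + 2 * M + G * M + A * (1 + M) ^ 2 + A * (G + M) * M := by
  have hM : 0 ≤ M := (abs_nonneg _).trans hfb.1
  have hzG : |z.2| ≤ G := hz.trans (by nlinarith)
  have hs : |z.2 - ε * m z.1| ≤ G + M :=
    (abs_sub_mul_le hε hz hmb).trans (by nlinarith)
  have hAa : |A| ≤ A := (abs_of_nonneg hA).le
  refine ⟨?_, fun d hd => ?_, fun e d he hd => ?_⟩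
  · have h1 := abs_mul_le_mul hzG hfb.1
    have h2 : |A / 2 * (z.2 - ε * m z.1) ^ 2| ≤ A / 2 * (G + M) ^ 2 := by
      rw [abs_mul, abs_of_nonneg (by positivity : 0 ≤ A / 2), abs_pow]
      gcongr
    calc _ ≤ |ψ z.1 + z.2 * f z.1| + |A / 2 * (z.2 - ε * m z.1) ^ 2| := abs_add_le _ _
      _ ≤ |ψ z.1| + |z.2 * f z.1| + |A / 2 * (z.2 - ε * m z.1) ^ 2| := by
        gcongr; exact abs_add_le _ _
      _ ≤ _ := by linarith [hψb.1]
  · have hd1 : ‖d.1‖ ≤ 1 := (norm_fst_le d).trans hd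
    have hd2 : |d.2| ≤ 1 := (norm_snd_le d).trans hd
    have h1 := abs_apply_le hψb.2.1 hd1
    have h2 := abs_mul_le_mul hd2 hfb.1
    have h3 := abs_mul_le_mul hzG (abs_apply_le hfb.2.1 hd1)
    have h4 := abs_mul_le_mul (abs_mul_le_mul hAa hs) (abs_sub_fderiv_le (z := z) hε hε1 hmb hd)
    rw [fderiv_ansatz hψ hf hm]
    rw [abs_le] at h1 h2 h3 h4 ⊢
    constructor <;> linarith [h1.1, h2.1, h3.1, h4.1, h1.2, h2.2, h3.2, h4.2]
  · have hd1 : ‖d.1‖ ≤ 1 := (norm_fst_le d).trans hd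
    have hd2 : |d.2| ≤ 1 := (norm_snd_le d).trans hd
    have he1 : ‖e.1‖ ≤ 1 := (norm_fst_le e).trans he
    have he2 : |e.2| ≤ 1 := (norm_snd_le e).trans he
    have h1 := abs_apply₂_le zero_le_one hψb.2.2 he1 hd1
    have h2 := abs_mul_le_mul hd2 (abs_apply_le hfb.2.1 he1)
    have h3 := abs_mul_le_mul he2 (abs_apply_le hfb.2.1 hd1)
    have h4 : |z.2 * fderiv ℝ (fderiv ℝ f) z.1 e.1 d.1| ≤ G * M := by
      have h5 := abs_apply₂_le hε.le hfb.2.2 he1 hd1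
      have h6 : |z.2 / ε| ≤ G := by
        rw [abs_div, abs_of_pos hε, div_le_iff₀ hε]; linarith
      have h7 := abs_mul_le_mul h6 h5
      rwa [← mul_assoc, div_mul_cancel₀ _ hε.ne'] at h7
    have h5 := abs_mul_le_mul (abs_mul_le_mul hAa (abs_sub_fderiv_le (z := z) hε hε1 hmb he))
      (abs_sub_fderiv_le (z := z) hε hε1 hmb hd)
    have h6 := abs_mul_le_mul (abs_mul_le_mul hAa hs) (abs_apply₂_le hε.le hmb.2.2 he1 hd1)
    rw [fderiv_fderiv_ansatz hψ hf hm]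
    rw [abs_le] at h1 h2 h3 h4 h5 h6 ⊢
    constructor <;> linarith [h1.1, h2.1, h3.1, h4.1, h5.1, h6.1, h1.2, h2.2, h3.2, h4.2, h5.2,
      h6.2]

/-- The oblique derivative on the top (`σ = 1`) and the bottom (`σ = -1`). The terms of order one
cancel by the choice `f ≈ β₀ - γ₀ · Dψ`; at order `ε` the quadratic term of the ansatz dominates. -/
theorem le_fderiv_ansatz (hψ : ContDiff ℝ 2 ψ) (hf : ContDiff ℝ 2 f) (hm : ContDiff ℝ 2 m)
    (hA : 0 ≤ A) (hε : 0 < ε) (hz : |z.2| ≤ ε * G)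
    (hψb : ‖fderiv ℝ ψ z.1‖ ≤ Ψ) (hfb : ‖fderiv ℝ f z.1‖ ≤ M) (hmb : ‖fderiv ℝ m z.1‖ ≤ M)
    {σ b β M₀ Γ θ : ℝ} (hσ : σ = 1 ∨ σ = -1) {c : Base N} {g : Pt N} (hg2 : g.2 = σ)
    (hM₀ : 0 ≤ M₀) (hgΓ : ‖g.1‖ ≤ Γ) (hgc : ‖g.1 - σ • c‖ ≤ M₀ * |z.2|)
    (hβ : |β - σ * b| ≤ M₀ * |z.2|) (hfm : |f z.1 - (b - fderiv ℝ ψ z.1 c)| ≤ M * ε)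
    (hθ : 0 ≤ θ) (hgap : ε * θ ≤ σ * (z.2 - ε * m z.1)) (hsmall : M * Γ * ε ≤ 1 / 2) :
    ε * (A * θ / 2 - (Ψ * (M₀ * G) + M + G * (M * Γ) + M₀ * G)) ≤
      fderiv ℝ (ansatz ψ f m A ε) z g - β := by
  rw [fderiv_ansatz hψ hf hm, hg2]
  have hz' : M₀ * |z.2| ≤ ε * (M₀ * G) := by nlinarith
  have h1 : |fderiv ℝ ψ z.1 (g.1 - σ • c)| ≤ Ψ * (ε * (M₀ * G)) :=
    abs_apply_le hψb (hgc.trans hz')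
  rw [map_sub, map_smul, smul_eq_mul] at h1
  have h2 : |z.2 * fderiv ℝ f z.1 g.1| ≤ (ε * G) * (M * Γ) :=
    abs_mul_le_mul hz (abs_apply_le hfb hgΓ)
  have h3 : |σ * (f z.1 - (b - fderiv ℝ ψ z.1 c))| ≤ M * ε := by
    rw [abs_mul]
    rcases hσ with rfl | rfl <;> simpa using hfm
  have h4 := abs_apply_le hmb hgΓ
  have h5 : |σ * (ε * fderiv ℝ m z.1 g.1)| ≤ 1 / 2 := by
    have : |σ| = 1 := by rcases hσ with rfl | rfl <;> simp
    rw [abs_mul, this, one_mul, abs_mul, abs_of_pos hε]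
    nlinarith
  have hσ2 : σ * σ = 1 := by rcases hσ with rfl | rfl <;> norm_num
  have h6 : A * (z.2 - ε * m z.1) * (σ - ε * fderiv ℝ m z.1 g.1)
      = A * (σ * (z.2 - ε * m z.1)) * (1 - σ * (ε * fderiv ℝ m z.1 g.1)) := by
    linear_combination (A * (z.2 - ε * m z.1) * (ε * fderiv ℝ m z.1 g.1)) * hσ2
  have h7 : A * (ε * θ) * (1 / 2) ≤
      A * (σ * (z.2 - ε * m z.1)) * (1 - σ * (ε * fderiv ℝ m z.1 g.1)) := by
    refine mul_le_mul (mul_le_mul_of_nonneg_left hgap hA) ?_ (by norm_num) ?_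
    · linarith [(abs_le.1 h5).2]
    · exact mul_nonneg hA ((mul_nonneg hε.le hθ).trans hgap)
  rw [h6]
  have hβ' := hβ.trans hz'
  rw [abs_le] at h1 h2 h3 hβ'
  linarith [h1.1, h2.1, h3.1, hβ'.2]

/-- The lateral oblique derivative is that of `ψ`, up to small terms. -/
theorem abs_fderiv_ansatz_sub_le (hψ : ContDiff ℝ 2 ψ) (hf : ContDiff ℝ 2 f) (hm : ContDiff ℝ 2 m)
    (hA : 0 ≤ A) (hε : 0 < ε) (hε1 : ε ≤ 1) (hz : |z.2| ≤ ε * G) (hfb : JetBound f z.1 ε M)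
    (hmb : JetBound m z.1 ε M) {η Γ : ℝ} {g : Pt N} (hg2 : |g.2| ≤ η) (hgΓ : ‖g‖ ≤ Γ) :
    |fderiv ℝ (ansatz ψ f m A ε) z g - fderiv ℝ ψ z.1 g.1| ≤
      η * M + ε * (G * (M * Γ) + A * (G + M) * ((1 + M) * Γ)) := by
  rw [fderiv_ansatz hψ hf hm]
  have h1 := abs_mul_le_mul hg2 hfb.1
  have h2 := abs_mul_le_mul hz (abs_apply_le hfb.2.1 ((norm_fst_le g).trans hgΓ))
  have h3 := abs_mul_le_mul (abs_mul_le_mul (abs_of_nonneg hA).le (abs_sub_mul_le hε hz hmb))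
    (abs_sub_fderiv_le (z := z) hε hε1 hmb hgΓ)
  rw [abs_le] at h1 h2 h3 ⊢
  constructor <;> linarith [h1.1, h2.1, h3.1, h1.2, h2.2, h3.2]

end Estimates

theorem norm_grad_le {N : ℕ} {φ : Pt N → ℝ} {z : Pt N} {R : ℝ} (hR : 0 ≤ R)
    (h : ∀ d : Pt N, ‖d‖ ≤ 1 → |fderiv ℝ φ z d| ≤ R) : ‖grad φ z‖ ≤ R := by
  have h0 : ‖fderiv ℝ φ z‖ ≤ R := by
    refine ContinuousLinearMap.opNorm_le_of_unit_norm hR fun d hd => ?_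
    exact h d hd.le
  refine norm_prod_le_iff.2 ⟨?_, ?_⟩
  · have h1 := dot_grad φ z ((grad φ z).1, 0)
    simp only [dot, zero_mul, add_zero, real_inner_self_eq_norm_sq] at h1
    have h2 : |fderiv ℝ φ z ((grad φ z).1, 0)| ≤ R * ‖(grad φ z).1‖ :=
      abs_apply_le h0 (by simp)
    by_contra! hlt
    have := le_abs_self (fderiv ℝ φ z ((grad φ z).1, 0))
    nlinarith
  · exact h _ (by simp [dir])

theorem abs_snd_le_of_mem_slab {N : ℕ} {Ω : Set (Base N)} {gm gp : Base N → ℝ} {G : ℝ}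
    (hgm : ∀ x ∈ closure Ω, |gm x| ≤ G) (hgp : ∀ x ∈ closure Ω, |gp x| ≤ G) {ε : ℝ} (hε : 0 < ε)
    {z : Pt N} (hz : z ∈ slab Ω gm gp ε) : |z.2| ≤ ε * G := by
  obtain ⟨hx, h1, h2⟩ := hz
  have h3 := (abs_le.1 (hgm z.1 hx)).1
  have h4 := (abs_le.1 (hgp z.1 hx)).2
  rw [abs_le]
  constructor <;> nlinarith

theorem eventually_slab_subset {N : ℕ} {Ω : Set (Base N)} (hb : Bornology.IsBounded Ω)
    {gm gp : Base N → ℝ} (hgm : IsC1On gm (closure Ω)) (hgp : IsC1On gp (closure Ω)) :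
    ∀ᶠ ε : ℝ in 𝓝[>] 0, slab Ω gm gp ε ⊆ dataDomain Ω := by
  have hc := hb.isCompact_closure
  obtain ⟨gm', hgm', hm⟩ := hgm
  obtain ⟨gp', hgp', hp⟩ := hgp
  obtain ⟨Gm, hGm⟩ := hc.exists_bound_of_continuousOn (hgm'.continuous.continuousOn.congr hm)
  obtain ⟨Gp, hGp⟩ := hc.exists_bound_of_continuousOn (hgp'.continuous.continuousOn.congr hp)
  filter_upwards [eventually_mul_lt (c := max Gm Gp) one_pos, self_mem_nhdsWithin] with ε h hε z hz
  have := abs_snd_le_of_mem_slab (G := max Gm Gp) (fun x hx => (hGm x hx).trans (le_max_left _ _))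
    (fun x hx => (hGp x hx).trans (le_max_right _ _)) hε hz
  exact ⟨hz.1, abs_le.1 (this.trans (by linarith))⟩

/-- A weight `ψ(x)` adapted to the lateral condition: under an oblique condition its derivative along
`γ` exceeds `β` by a fixed amount; under a Dirichlet condition nothing is required of it. -/
theorem IsLateralOp.exists_weight {N : ℕ} {Ω : Set (Base N)} {B : Pt N → ℝ → Pt N → ℝ}
    (hB : IsLateralOp Ω B) (hΩ : IsOpen Ω) (hb : Bornology.IsBounded Ω) (h1 : HasC1Boundary Ω) :
    ∃ ψ : Base N → ℝ, ContDiff ℝ 3 ψ ∧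
      ((∃ γ : Pt N → Pt N, ∃ β : Pt N → ℝ, ContinuousOn γ (lateralDataDomain Ω) ∧
        (∀ x ∈ frontier Ω, (γ (x, 0)).2 = 0) ∧
        (∀ z ∈ lateralDataDomain Ω, β z + 2 ≤ fderiv ℝ ψ z.1 (γ z).1) ∧ B = obliqueOp γ β) ∨
      ∃ β : Pt N → ℝ, ContinuousOn β (lateralDataDomain Ω) ∧ B = dirichletOp β) := by
  rcases hB with ⟨γ, β, hγ, hβ, hpos, h0, rfl⟩ | ⟨β, hβ, rfl⟩
  · obtain ⟨-, -, ψ, -, -, hψ, -, -, hψ1⟩ := exists_defining_and_smooth hΩ hb h1 hγ hpos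
    have hK : IsCompact (lateralDataDomain Ω) :=
      (Metric.isCompact_of_isClosed_isBounded isClosed_frontier
        (hb.closure.subset frontier_subset_closure)).prod isCompact_Icc
    obtain ⟨b, hb⟩ := hK.exists_bound_of_continuousOn hβ
    refine ⟨fun x => (|b| + 2) * ψ x, contDiff_const.mul hψ,
      Or.inl ⟨γ, β, hγ, h0, fun z hz => ?_, rfl⟩⟩
    rw [fderiv_const_mul (hψ.differentiable (by norm_num) _), smul_apply, smul_eq_mul]
    have h2 := hψ1 z hz
    have h3 := (abs_le.1 ((Real.norm_eq_abs _).symm.trans_le (hb z hz))).2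
    have h4 := le_abs_self b
    have h5 := abs_nonneg b
    nlinarith
  · exact ⟨fun _ => 0, contDiff_const, Or.inr ⟨β, hβ, rfl⟩⟩

set_option maxHeartbeats 800000 in
/-- Strict classical supersolutions, bounded uniformly as `ε → 0`. -/
theorem exists_strict_supersolution {N : ℕ} {Ω : Set (Base N)} (hΩ : IsOpen Ω)
    (hb : Bornology.IsBounded Ω) (hΩ1 : HasC1Boundary Ω) {gm gp : Base N → ℝ}
    (hgm : IsC1On gm (closure Ω)) (hgp : IsC1On gp (closure Ω))
    (hg : ∀ x ∈ closure Ω, gm x < gp x) {F : Mat N → Pt N → ℝ → Pt N → ℝ}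
    (hF : IsProperElliptic Ω F) {γm γp : Pt N → Pt N} {βm βp : Pt N → ℝ}
    (hγm2 : ∀ z ∈ dataDomain Ω, (γm z).2 = -1) (hγp2 : ∀ z ∈ dataDomain Ω, (γp z).2 = 1)
    {γo : Base N → Base N} {βo : Base N → ℝ}
    (hβo : IsC1On βo (closure Ω)) (hγo : IsC1On γo (closure Ω))
    (hγp : HasLinearDeviation Ω (fun z => (γp z).1) γo)
    (hγm : HasLinearDeviation Ω (fun z => (γm z).1) (fun x => -γo x))
    (hβp : HasLinearDeviation Ω βp βo) (hβm : HasLinearDeviation Ω βm (fun x => -βo x))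
    {B : Pt N → ℝ → Pt N → ℝ} (hB : IsLateralOp Ω B) :
    ∃ C₀ : ℝ, ∀ᶠ ε : ℝ in 𝓝[>] 0, ∃ φ : Pt N → ℝ, ContDiff ℝ 2 φ ∧
      (∀ z ∈ slab Ω gm gp ε, |φ z| ≤ C₀) ∧
      (∀ z ∈ slab Ω gm gp ε, 0 < F (hess φ z) (grad φ z) (φ z) z) ∧
      (∀ z ∈ slab Ω gm gp ε, z.1 ∈ frontier Ω → 0 < B (grad φ z) (φ z) z) ∧
      (∀ z ∈ slab Ω gm gp ε, z.2 = ε * gm z.1 → βm z < dot (γm z) (grad φ z)) ∧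
      (∀ z ∈ slab Ω gm gp ε, z.2 = ε * gp z.1 → βp z < dot (γp z) (grad φ z)) := by
  have hc := hb.isCompact_closure
  have hsub := eventually_slab_subset hb hgm hgp
  have hfc : IsCompact (frontier Ω) := hc.of_isClosed_subset isClosed_frontier
    frontier_subset_closure
  have hLc : IsCompact (lateralDataDomain Ω) := hfc.prod isCompact_Icc
  obtain ⟨gm', hgm', hgme⟩ := hgm
  obtain ⟨gp', hgp', hgpe⟩ := hgp
  obtain ⟨b, hbC, hbe⟩ := hβo
  obtain ⟨c, hcC, hce⟩ := hγo
  obtain ⟨ψ, hψ3, hlat⟩ := hB.exists_weight hΩ hb hΩ1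
  have hψ : ContDiff ℝ 2 ψ := hψ3.of_le (by norm_num)
  have hDψ : ContDiff ℝ 2 (fderiv ℝ ψ) := hψ3.fderiv_right (by norm_num)
  obtain ⟨Gm, hGm⟩ := hc.exists_bound_of_continuousOn (hgm'.continuous.continuousOn.congr hgme)
  obtain ⟨Gp, hGp⟩ := hc.exists_bound_of_continuousOn (hgp'.continuous.continuousOn.congr hgpe)
  obtain ⟨Γ₀, hΓ₀⟩ := hc.exists_bound_of_continuousOn (hcC.continuous.continuousOn.congr hce)
  obtain ⟨Ψ₀, hΨ₀⟩ := hc.exists_bound_of_continuousOn hψ.continuous.continuousOn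
  obtain ⟨Ψ₁, hΨ₁⟩ := hc.exists_bound_of_continuousOn hDψ.continuous.continuousOn
  obtain ⟨Ψ₂, hΨ₂⟩ := hc.exists_bound_of_continuousOn
    (hDψ.continuous_fderiv (by norm_num)).continuousOn
  set Ψ := max (max Ψ₀ Ψ₁) Ψ₂ with hΨ
  have hψb : ∀ x ∈ closure Ω, JetBound ψ x 1 Ψ := fun x hx =>
    ⟨(hΨ₀ x hx).trans ((le_max_left _ _).trans (le_max_left _ _)),
      (hΨ₁ x hx).trans ((le_max_right _ _).trans (le_max_left _ _)),
      by rw [one_mul]; exact (hΨ₂ x hx).trans (le_max_right _ _)⟩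
  set G := max (max Gm Gp) 0 with hG
  have hG0 : 0 ≤ G := le_max_right _ _
  have hGmG : ∀ x ∈ closure Ω, |gm x| ≤ G := fun x hx =>
    (hGm x hx).trans ((le_max_left _ _).trans (le_max_left _ _))
  have hGpG : ∀ x ∈ closure Ω, |gp x| ≤ G := fun x hx =>
    (hGp x hx).trans ((le_max_right _ _).trans (le_max_left _ _))
  obtain ⟨θ, hθ, hgap⟩ : ∃ θ : ℝ, 0 < θ ∧ ∀ x ∈ closure Ω, 4 * θ ≤ gp x - gm x := by
    rcases (closure Ω).eq_empty_or_nonempty with he | hne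
    · exact ⟨1, one_pos, by simp [he]⟩
    · obtain ⟨x, hx, hmin⟩ := hc.exists_isMinOn hne
        ((hgp'.continuous.continuousOn.congr hgpe).sub (hgm'.continuous.continuousOn.congr hgme))
      refine ⟨(gp x - gm x) / 4, by linarith [hg x hx], fun w hw => ?_⟩
      have : gp x - gm x ≤ gp w - gm w := hmin hw
      linarith
  set f₀ : Base N → ℝ := fun x => b x - fderiv ℝ ψ x (c x) with hf₀
  have hf₀C : ContDiff ℝ 1 f₀ := hbC.sub ((hDψ.of_le (by norm_num)).clm_apply hcC)
  set m₀ : Base N → ℝ := fun x => (gp' x + gm' x) / 2 with hm₀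
  have hm₀C : ContDiff ℝ 1 m₀ := (hgp'.add hgm').div_const 2
  obtain ⟨Mf, hMf, Hf⟩ := exists_smooth_approx_of_contDiff hf₀C hb.closure
  obtain ⟨Mm, hMm, Hm⟩ := exists_smooth_approx_of_contDiff hm₀C hb.closure
  obtain ⟨Vf, hVf⟩ := hc.exists_bound_of_continuousOn hf₀C.continuous.continuousOn
  obtain ⟨Vm, hVm⟩ := hc.exists_bound_of_continuousOn hm₀C.continuous.continuousOn
  set M := max (Mf + |Vf|) (Mm + |Vm|) with hM
  have hMfM : Mf + |Vf| ≤ M := le_max_left _ _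
  have hMmM : Mm + |Vm| ≤ M := le_max_right _ _
  have hM0 : 0 ≤ M := (by positivity : 0 ≤ Mf + |Vf|).trans hMfM
  obtain ⟨M₁, δ₁, hδ₁, D₁⟩ := hγp
  obtain ⟨M₂, δ₂, hδ₂, D₂⟩ := hγm
  obtain ⟨M₃, δ₃, hδ₃, D₃⟩ := hβp
  obtain ⟨M₄, δ₄, hδ₄, D₄⟩ := hβm
  set M₀ := |M₁| + |M₂| + |M₃| + |M₄| with hM₀
  have hM₀0 : 0 ≤ M₀ := by positivity
  have hle : ∀ {M' v y : ℝ}, M' ≤ M₀ → v ≤ M' * |y| → v ≤ M₀ * |y| := fun h1 h2 =>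
    h2.trans (mul_le_mul_of_nonneg_right h1 (abs_nonneg _))
  have q1 := le_abs_self M₁
  have q2 := le_abs_self M₂
  have q3 := le_abs_self M₃
  have q4 := le_abs_self M₄
  have p1 := abs_nonneg M₁
  have p2 := abs_nonneg M₂
  have p3 := abs_nonneg M₃
  have p4 := abs_nonneg M₄
  set Γ := |Γ₀| + M₀ with hΓ
  -- `C₁` collects the terms of order `ε` on the top and the bottom that `A` has to dominate.
  set C₁ := Ψ * (M₀ * G) + M + G * (M * Γ) + M₀ * G with hC₁
  set A := 2 * (|C₁| + 1) / θ with hA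
  have hA0 : 0 ≤ A := by positivity
  have hAθ : A * θ / 2 = |C₁| + 1 := by rw [hA]; field_simp
  set S := Ψ + G * M + A / 2 * (G + M) ^ 2 with hS
  set R₁ := Ψ + M + G * M + A * (G + M) * (1 + M) with hR₁
  set R₂ := Ψ + 2 * M + G * M + A * (1 + M) ^ 2 + A * (G + M) * M with hR₂
  set R := max (max R₁ R₂) 0 with hR
  obtain ⟨r₀, hr₀⟩ := hF.exists_lower_bound hb R
  -- The lateral condition holds strictly: by the weight `ψ` if it is oblique, since the other terms are
  -- small with `ε`, and for values above a threshold `b₀` if it is of Dirichlet type.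
  obtain ⟨b₀, hlat'⟩ : ∃ b₀ : ℝ, ∀ᶠ ε : ℝ in 𝓝[>] 0, ∀ z ∈ lateralDataDomain Ω, |z.2| ≤ ε * G →
      ∀ f m : Base N → ℝ, ContDiff ℝ 2 f → ContDiff ℝ 2 m → JetBound f z.1 ε M →
      JetBound m z.1 ε M → ∀ C r : ℝ, b₀ ≤ r →
      0 < B (grad (fun w => ansatz ψ f m A ε w + C) z) r z := by
    rcases hlat with ⟨γ, β, hγ, h0, hγβ, rfl⟩ | ⟨β, hβ, rfl⟩
    · obtain ⟨ΓL, hΓL⟩ := hLc.exists_bound_of_continuousOn hγ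
      obtain ⟨δ, hδ, hsm⟩ := eventually_small_of_eq_zero hfc (f := fun z => (γ z).2)
        (continuous_snd.comp_continuousOn hγ) h0 (η := 1 / (2 * (M + 1))) (by positivity)
      refine ⟨0, ?_⟩
      filter_upwards [eventually_mul_lt (c := G) hδ, eventually_mul_lt (c := 1) one_pos,
        eventually_mul_lt (c := G * (M * ΓL) + A * (G + M) * ((1 + M) * ΓL)) one_pos,
        self_mem_nhdsWithin] with ε e1 e2 e3 hε z hz hzG f m hf hm hfb hmb C r _
      have h2 := abs_fderiv_ansatz_sub_le hψ hf hm hA0 hε (by linarith) hzG hfb hmb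
        (hsm z hz (by linarith)).le (hΓL z hz)
      have h3 : 1 / (2 * (M + 1)) * M ≤ 1 / 2 := by
        rw [div_mul_eq_mul_div, div_le_div_iff₀ (by positivity) (by norm_num)]; linarith
      simp only [obliqueOp]
      rw [grad_add_const, dot_grad]
      linarith [hγβ z hz, (abs_le.1 h2).1]
    · obtain ⟨b₀, hb₀⟩ := hLc.exists_bound_of_continuousOn hβ
      refine ⟨b₀ + 1, Eventually.of_forall fun ε z hz _ f m _ _ _ _ C r hr => ?_⟩
      have := (abs_le.1 ((Real.norm_eq_abs _).symm.trans_le (hb₀ z hz))).2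
      simp only [dirichletOp]
      linarith
  set C := S + max r₀ b₀ with hCdef
  refine ⟨S + |C|, ?_⟩
  filter_upwards [hsub, hlat', eventually_mul_lt (c := G) hδ₁, eventually_mul_lt (c := G) hδ₂,
    eventually_mul_lt (c := G) hδ₃, eventually_mul_lt (c := G) hδ₄,
    eventually_mul_lt (c := 1) one_pos, eventually_mul_lt (c := M) hθ,
    eventually_mul_lt (c := M * Γ) (by norm_num : (0 : ℝ) < 1 / 2), self_mem_nhdsWithin]
    with ε hsub hlat' e1 e2 e3 e4 e5 e6 e7 hε
  have hε : 0 < ε := hε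
  have hε1 : ε ≤ 1 := by linarith
  obtain ⟨f, hf, hf0, hf1, hf2⟩ := Hf ε hε
  obtain ⟨m, hm, hm0, hm1, hm2⟩ := Hm ε hε
  have hfb : ∀ x ∈ closure Ω, JetBound f x ε M := fun x hx => by
    have h1 := abs_le.1 (hf0 x hx)
    have h2 := abs_le.1 ((Real.norm_eq_abs _).symm.trans_le ((hVf x hx).trans (le_abs_self Vf)))
    have h3 : Mf * ε ≤ Mf := mul_le_of_le_one_right hMf hε1
    have h4 := abs_nonneg Vf
    exact ⟨abs_le.2 ⟨by linarith, by linarith⟩, by linarith [hf1 x], by linarith [hf2 x]⟩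
  have hmb : ∀ x ∈ closure Ω, JetBound m x ε M := fun x hx => by
    have h1 := abs_le.1 (hm0 x hx)
    have h2 := abs_le.1 ((Real.norm_eq_abs _).symm.trans_le ((hVm x hx).trans (le_abs_self Vm)))
    have h3 : Mm * ε ≤ Mm := mul_le_of_le_one_right hMm hε1
    have h4 := abs_nonneg Vm
    exact ⟨abs_le.2 ⟨by linarith, by linarith⟩, by linarith [hm1 x], by linarith [hm2 x]⟩
  have hfM : ∀ x ∈ closure Ω, |f x - f₀ x| ≤ M * ε := fun x hx =>
    (hf0 x hx).trans (mul_le_mul_of_nonneg_right (by linarith [abs_nonneg Vf]) hε.le)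
  have hmM : ∀ x ∈ closure Ω, |m x - (gp x + gm x) / 2| ≤ θ := fun x hx => by
    have h1 := (hm0 x hx).trans
      (mul_le_mul_of_nonneg_right (by linarith [abs_nonneg Vm] : Mm ≤ M) hε.le)
    simp only [hm₀] at h1
    rw [hgpe hx, hgme hx]
    exact h1.trans e6.le
  have hz2 : ∀ z ∈ slab Ω gm gp ε, |z.2| ≤ ε * G := fun z hz =>
    abs_snd_le_of_mem_slab hGmG hGpG hε hz
  have hjet := fun z (hz : z ∈ slab Ω gm gp ε) => ansatz_jet_le hψ hf hm hA0 hε hε1 hG0 (hz2 z hz)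
    (hψb z.1 hz.1) (hfb z.1 hz.1) (hmb z.1 hz.1)
  have hval : ∀ z ∈ slab Ω gm gp ε, max r₀ b₀ ≤ ansatz ψ f m A ε z + C := fun z hz => by
    linarith [(abs_le.1 (hjet z hz).1).1]
  have hφ := contDiff_ansatz (A := A) (ε := ε) hψ hf hm
  have hpos : 0 < ε * (A * θ / 2 - C₁) :=
    mul_pos hε (by rw [hAθ]; linarith [le_abs_self C₁])
  -- top and bottom at once, with `σ = ±1` the vertical component of the oblique vector
  have key : ∀ z ∈ slab Ω gm gp ε, ∀ (g : Pt N) (β : ℝ) {σ : ℝ}, σ = 1 ∨ σ = -1 → g.2 = σ →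
      ‖g.1 - σ • γo z.1‖ ≤ M₀ * |z.2| → |β - σ * βo z.1| ≤ M₀ * |z.2| →
      ε * θ ≤ σ * (z.2 - ε * m z.1) → β < dot g (grad (fun w => ansatz ψ f m A ε w + C) z) := by
    intro z hz g β σ hσ hg2 h1 h2 h6
    rw [grad_add_const, dot_grad]
    rw [hce hz.1] at h1
    rw [hbe hz.1] at h2
    have h3 : ‖g.1‖ ≤ Γ := by
      have h4 : M₀ * |z.2| ≤ M₀ := mul_le_of_le_one_right hM₀0 (abs_le.2 (hsub hz).2)
      have h5 : ‖σ • c z.1‖ ≤ |Γ₀| := by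
        have : ‖c z.1‖ ≤ |Γ₀| := by
          rw [← hce hz.1]; exact (hΓ₀ z.1 hz.1).trans (le_abs_self _)
        rcases hσ with rfl | rfl <;> simpa using this
      calc ‖g.1‖ = ‖(g.1 - σ • c z.1) + σ • c z.1‖ := by rw [sub_add_cancel]
        _ ≤ |Γ₀| + M₀ := (norm_add_le _ _).trans (by linarith)
    have := le_fderiv_ansatz hψ hf hm hA0 hε (hz2 z hz) (hψb z.1 hz.1).2.1 (hfb z.1 hz.1).2.1
      (hmb z.1 hz.1).2.1 hσ hg2 hM₀0 h3 h1 h2 (hfM z.1 hz.1) hθ.le h6 e7.le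
    linarith
  refine ⟨fun w => ansatz ψ f m A ε w + C, hφ.add contDiff_const, fun z hz => ?_, fun z hz => ?_,
    fun z hz hzf => ?_, fun z hz hzg => ?_, fun z hz hzg => ?_⟩
  · exact (abs_add_le _ _).trans (by linarith [(hjet z hz).1])
  · refine hr₀ _ (hess_isSymm (hφ.add contDiff_const) z) (fun i j => ?_) _ ?_ z (hsub hz) _
      ((le_max_left _ _).trans (hval z hz))
    · have hdir : ∀ i : Fin N ⊕ Unit, ‖(dir i : Pt N)‖ ≤ 1 := by
        rintro (i | i) <;> simp [dir, Prod.norm_def]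
      rw [hess_add_const]
      exact ((hjet z hz).2.2 _ _ (hdir i) (hdir j)).trans
        ((le_max_right _ _).trans (le_max_left _ _))
    · rw [grad_add_const]
      exact norm_grad_le (le_max_right _ _) fun d hd => ((hjet z hz).2.1 d hd).trans
        ((le_max_left _ _).trans (le_max_left _ _))
  · exact hlat' z ⟨hzf, (hsub hz).2⟩ (hz2 z hz) f m hf hm (hfb z.1 hz.1) (hmb z.1 hz.1) C _
      ((le_max_right _ _).trans (hval z hz))
  · refine key z hz _ _ (Or.inr rfl) (hγm2 z (hsub hz)) ?_ ?_ ?_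
    · rw [neg_one_smul]
      exact hle (by linarith) (D₂ z.1 hz.1 z.2 (hsub hz).2 ((hz2 z hz).trans_lt (by linarith)))
    · rw [neg_one_mul]
      exact hle (by linarith) (D₄ z.1 hz.1 z.2 (hsub hz).2 ((hz2 z hz).trans_lt (by linarith)))
    · have h7 := (abs_le.1 (hmM z.1 hz.1)).1
      have : θ ≤ m z.1 - gm z.1 := by linarith [hgap z.1 hz.1]
      rw [hzg]; nlinarith
  · refine key z hz _ _ (Or.inl rfl) (hγp2 z (hsub hz)) ?_ ?_ ?_
    · rw [one_smul]
      exact hle (by linarith) (D₁ z.1 hz.1 z.2 (hsub hz).2 ((hz2 z hz).trans_lt (by linarith)))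
    · rw [one_mul]
      exact hle (by linarith) (D₃ z.1 hz.1 z.2 (hsub hz).2 ((hz2 z hz).trans_lt (by linarith)))
    · have h7 := (abs_le.1 (hmM z.1 hz.1)).2
      have : θ ≤ gp z.1 - m z.1 := by linarith [hgap z.1 hz.1]
      rw [hzg]; nlinarith

/-! ### Inward directions -/

/-- Moving from `z` against `d` by a small amount leads into `U`. -/
def PointsInto {N : ℕ} (U : Set (Pt N)) (z d : Pt N) : Prop :=
  ∀ᶠ h : ℝ in 𝓝[>] 0, z - h • d ∈ U

theorem hasDerivAt_sub_smul {E : Type*} [NormedAddCommGroup E] [NormedSpace ℝ E] {f : E → ℝ}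
    {z : E} (hf : DifferentiableAt ℝ f z) (d : E) :
    HasDerivAt (fun h : ℝ => f (z - h • d)) (-fderiv ℝ f z d) 0 := by
  have h1 : HasDerivAt (fun h : ℝ => z - h • d) (-d) 0 := by
    simpa using ((hasDerivAt_id (0 : ℝ)).smul_const d).const_sub z
  have h2 : HasFDerivAt f (fderiv ℝ f z) (z - (0 : ℝ) • d) := by simpa using hf.hasFDerivAt
  have h3 := h2.comp_hasDerivAt (0 : ℝ) h1
  rw [map_neg] at h3
  exact h3

theorem fderiv_nonneg_of_pointsInto {N : ℕ} {U : Set (Pt N)} {f : Pt N → ℝ} {z d : Pt N}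
    (hf : DifferentiableAt ℝ f z) (hz : IsLocalMaxOn f U z) (hd : PointsInto U z d) :
    0 ≤ fderiv ℝ f z d := by
  have h1 := (hasDerivAt_sub_smul hf d).tendsto_slope_zero_right
  have hc : Tendsto (fun h : ℝ => z - h • d) (𝓝[>] 0) (𝓝[U] z) := by
    refine tendsto_nhdsWithin_iff.2 ⟨?_, hd⟩
    have : Continuous fun h : ℝ => z - h • d := by fun_prop
    simpa using (this.tendsto 0).mono_left (nhdsWithin_le_nhds (s := Ioi (0 : ℝ)))
  have h2 : -fderiv ℝ f z d ≤ 0 := by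
    refine le_of_tendsto h1 ?_
    filter_upwards [hc.eventually hz, self_mem_nhdsWithin] with h hle hpos
    have hpos : 0 < h := hpos
    simp only [zero_add, zero_smul, sub_zero, smul_eq_mul]
    exact mul_nonpos_of_nonneg_of_nonpos (inv_nonneg.2 hpos.le) (by linarith)
  linarith

theorem eventually_neg_of_fderiv_pos {E : Type*} [NormedAddCommGroup E] [NormedSpace ℝ E]
    {f : E → ℝ} {z d : E} (hf : DifferentiableAt ℝ f z) (h0 : f z ≤ 0)
    (hd : f z = 0 → 0 < fderiv ℝ f z d) : ∀ᶠ h : ℝ in 𝓝[>] 0, f (z - h • d) < 0 := by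
  have h1 := hasDerivAt_sub_smul hf d
  rcases h0.lt_or_eq with hlt | heq
  · have := h1.continuousAt.tendsto
    simp only [zero_smul, sub_zero] at this
    exact nhdsWithin_le_nhds (this.eventually (Iio_mem_nhds hlt))
  · have h2 := h1.tendsto_slope_zero_right
    have h3 := h2.eventually (Iio_mem_nhds (neg_lt_zero.2 (hd heq)))
    filter_upwards [h3, self_mem_nhdsWithin] with h hlt hpos
    have hpos : 0 < h := hpos
    simp only [zero_add, zero_smul, sub_zero, smul_eq_mul, heq] at hlt
    by_contra! hge
    linarith [mul_nonneg (inv_nonneg.2 hpos.le) hge]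

/-- First-order criterion for a direction to point into the thin domain. -/
theorem pointsInto_thin {N : ℕ} {Ω : Set (Base N)} {gm gp gm' gp' : Base N → ℝ} {ε : ℝ}
    (hgm' : ContDiff ℝ 1 gm') (hgme : EqOn gm gm' (closure Ω))
    (hgp' : ContDiff ℝ 1 gp') (hgpe : EqOn gp gp' (closure Ω)) {z d : Pt N}
    (hz : z ∈ slab Ω gm gp ε) (hx : ∀ᶠ h : ℝ in 𝓝[>] 0, z.1 - h • d.1 ∈ Ω)
    (hm : z.2 = ε * gm z.1 → d.2 < ε * fderiv ℝ gm' z.1 d.1)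
    (hp : z.2 = ε * gp z.1 → ε * fderiv ℝ gp' z.1 d.1 < d.2) :
    PointsInto (thin Ω gm gp ε) z d := by
  have e4 : HasFDerivAt (fun w : Pt N => w.2) (ContinuousLinearMap.snd ℝ (Base N) ℝ) z :=
    hasFDerivAt_snd
  have em := ((hasFDerivAt_comp_fst (hgm'.differentiable one_ne_zero) z).const_mul ε).sub e4
  have ep := e4.sub ((hasFDerivAt_comp_fst (hgp'.differentiable one_ne_zero) z).const_mul ε)
  obtain ⟨hz0, hz1, hz2⟩ := hz
  rw [hgme hz0] at hm hz1
  rw [hgpe hz0] at hp hz2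
  have h1 := eventually_neg_of_fderiv_pos (d := d) em.differentiableAt (by simpa using hz1)
    (fun h => by
      rw [em.fderiv]; simpa using hm (by simp at h; linarith))
  have h2 := eventually_neg_of_fderiv_pos (d := d) ep.differentiableAt (by simpa using hz2)
    (fun h => by
      rw [ep.fderiv]; simpa using hp (by simp at h; linarith))
  filter_upwards [hx, h1, h2] with h hx h1 h2
  have hcl : z.1 - h • d.1 ∈ closure Ω := subset_closure hx
  refine ⟨hx, ?_, ?_⟩
  · rw [Prod.fst_sub, Prod.smul_fst, hgme hcl]
    simp at h1; simpa using h1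
  · rw [Prod.fst_sub, Prod.smul_fst, hgpe hcl]
    simp at h2; simpa using h2

theorem eventually_mem_of_isOpen {N : ℕ} {Ω : Set (Base N)} (hΩ : IsOpen Ω) {x : Base N}
    (hx : x ∈ Ω) (v : Base N) : ∀ᶠ h : ℝ in 𝓝[>] 0, x - h • v ∈ Ω := by
  have : Continuous fun h : ℝ => x - h • v := by fun_prop
  exact nhdsWithin_le_nhds (this.tendsto 0 |>.eventually (hΩ.mem_nhds (by simpa using hx)))

section Inward

variable {N : ℕ} {Ω : Set (Base N)} {gm gp : Base N → ℝ} {γm γp : Pt N → Pt N}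

/-- In thin domains the conditions on the top and the bottom are oblique. -/
theorem eventually_pointsInto_top_bottom (hΩ : IsOpen Ω) (hb : Bornology.IsBounded Ω)
    (hgm : IsC1On gm (closure Ω)) (hgp : IsC1On gp (closure Ω))
    (hg : ∀ x ∈ closure Ω, gm x < gp x)
    (hγm : ContinuousOn γm (dataDomain Ω)) (hγp : ContinuousOn γp (dataDomain Ω))
    (hγm2 : ∀ z ∈ dataDomain Ω, (γm z).2 = -1) (hγp2 : ∀ z ∈ dataDomain Ω, (γp z).2 = 1) :
    ∀ᶠ ε : ℝ in 𝓝[>] 0, ∀ z ∈ slab Ω gm gp ε, z.1 ∈ Ω →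
      (z.2 = ε * gm z.1 → PointsInto (thin Ω gm gp ε) z (γm z)) ∧
      (z.2 = ε * gp z.1 → PointsInto (thin Ω gm gp ε) z (γp z)) := by
  have hsub := eventually_slab_subset hb hgm hgp
  have hc := hb.isCompact_closure
  have hD : IsCompact (dataDomain Ω) := hc.prod isCompact_Icc
  obtain ⟨gm', hgm', hgme⟩ := hgm
  obtain ⟨gp', hgp', hgpe⟩ := hgp
  obtain ⟨Λm, hΛm⟩ := hc.exists_bound_of_continuousOn
    (hgm'.continuous_fderiv one_ne_zero).continuousOn
  obtain ⟨Λp, hΛp⟩ := hc.exists_bound_of_continuousOn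
    (hgp'.continuous_fderiv one_ne_zero).continuousOn
  obtain ⟨Γm, hΓm⟩ := hD.exists_bound_of_continuousOn hγm
  obtain ⟨Γp, hΓp⟩ := hD.exists_bound_of_continuousOn hγp
  filter_upwards [hsub, eventually_mul_lt (c := Λm * Γm) one_pos,
    eventually_mul_lt (c := Λp * Γp) one_pos, self_mem_nhdsWithin] with ε hsub em ep hε z hz hx
  have hε : 0 < ε := hε
  refine ⟨fun hzg => ?_, fun hzg => ?_⟩
  · refine pointsInto_thin hgm' hgme hgp' hgpe hz (eventually_mem_of_isOpen hΩ hx _)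
      (fun _ => ?_) (fun h => ?_)
    · have := abs_le.1 (abs_apply_le (hΛm z.1 hz.1) ((norm_fst_le _).trans (hΓm z (hsub hz))))
      rw [hγm2 z (hsub hz)]
      nlinarith [this.1]
    · exact absurd (hzg.symm.trans h) (mul_lt_mul_of_pos_left (hg z.1 hz.1) hε).ne
  · refine pointsInto_thin hgm' hgme hgp' hgpe hz (eventually_mem_of_isOpen hΩ hx _)
      (fun h => ?_) (fun _ => ?_)
    · exact absurd (h.symm.trans hzg) (mul_lt_mul_of_pos_left (hg z.1 hz.1) hε).ne
    · have := abs_le.1 (abs_apply_le (hΛp z.1 hz.1) ((norm_fst_le _).trans (hΓp z (hsub hz))))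
      rw [hγp2 z (hsub hz)]
      nlinarith [this.2]

/-- The lateral oblique direction points inwards away from the edges; at the edges a positive
combination with the top or bottom direction does, because `γ₂` is small at small heights. -/
theorem eventually_pointsInto_lateral (hΩ : IsOpen Ω) (hb : Bornology.IsBounded Ω)
    (hΩ1 : HasC1Boundary Ω)
    (hgm : IsC1On gm (closure Ω)) (hgp : IsC1On gp (closure Ω))
    (hg : ∀ x ∈ closure Ω, gm x < gp x)
    (hγm : ContinuousOn γm (dataDomain Ω)) (hγp : ContinuousOn γp (dataDomain Ω))
    (hγm2 : ∀ z ∈ dataDomain Ω, (γm z).2 = -1) (hγp2 : ∀ z ∈ dataDomain Ω, (γp z).2 = 1)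
    {γ : Pt N → Pt N} (hγ : ContinuousOn γ (lateralDataDomain Ω))
    (hpos : ∀ x ∈ frontier Ω, ∀ n, IsOutwardUnitNormal Ω x n → ∀ y ∈ Icc (-1 : ℝ) 1,
        0 < inner ℝ (γ (x, y)).1 n) (hγ0 : ∀ x ∈ frontier Ω, (γ (x, 0)).2 = 0) :
    ∃ τ : ℝ, 0 < τ ∧ ∀ᶠ ε : ℝ in 𝓝[>] 0, ∀ z ∈ slab Ω gm gp ε, z.1 ∈ frontier Ω →
      (z.2 ≠ ε * gm z.1 → z.2 ≠ ε * gp z.1 → PointsInto (thin Ω gm gp ε) z (γ z)) ∧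
      (z.2 = ε * gm z.1 → PointsInto (thin Ω gm gp ε) z (γ z + τ • γm z)) ∧
      (z.2 = ε * gp z.1 → PointsInto (thin Ω gm gp ε) z (γ z + τ • γp z)) := by
  have hsub := eventually_slab_subset hb hgm hgp
  have hc := hb.isCompact_closure
  have hD : IsCompact (dataDomain Ω) := hc.prod isCompact_Icc
  have hfc : IsCompact (frontier Ω) := hc.of_isClosed_subset isClosed_frontier
    frontier_subset_closure
  have hLc : IsCompact (lateralDataDomain Ω) := hfc.prod isCompact_Icc
  obtain ⟨ρ, κ, -, hρ, hκ, -, hρΩ, hρκ, -⟩ := exists_defining_and_smooth hΩ hb hΩ1 hγ hpos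
  obtain ⟨gm', hgm', hgme⟩ := hgm
  obtain ⟨gp', hgp', hgpe⟩ := hgp
  obtain ⟨Gm, hGm⟩ := hc.exists_bound_of_continuousOn (hgm'.continuous.continuousOn.congr hgme)
  obtain ⟨Gp, hGp⟩ := hc.exists_bound_of_continuousOn (hgp'.continuous.continuousOn.congr hgpe)
  obtain ⟨Λm, hΛm⟩ := hc.exists_bound_of_continuousOn
    (hgm'.continuous_fderiv one_ne_zero).continuousOn
  obtain ⟨Λp, hΛp⟩ := hc.exists_bound_of_continuousOn
    (hgp'.continuous_fderiv one_ne_zero).continuousOn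
  obtain ⟨Γm, hΓm⟩ := hD.exists_bound_of_continuousOn hγm
  obtain ⟨Γp, hΓp⟩ := hD.exists_bound_of_continuousOn hγp
  obtain ⟨ΓL, hΓL⟩ := hLc.exists_bound_of_continuousOn hγ
  obtain ⟨P, hP⟩ := hc.exists_bound_of_continuousOn (hρ.continuous_fderiv one_ne_zero).continuousOn
  set Γ := max Γm Γp with hΓ
  -- so small that adding `τ γ^±` keeps `γ` increasing for `ρ`
  set τ := κ / (2 * (|P * Γ| + 1)) with hτ
  have hτ0 : 0 < τ := by positivity
  have hτP : τ * (P * Γ) < κ := by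
    have h1 : τ * (|P * Γ| + 1) = κ / 2 := by rw [hτ]; field_simp
    have h2 := le_abs_self (P * Γ)
    nlinarith
  obtain ⟨δ, hδ, hsm⟩ := eventually_small_of_eq_zero hfc (f := fun z => (γ z).2)
    (continuous_snd.comp_continuousOn hγ) hγ0 (η := τ / 2) (by positivity)
  refine ⟨τ, hτ0, ?_⟩
  filter_upwards [hsub, eventually_mul_lt (c := Λm * (ΓL + τ * Γ)) (half_pos hτ0),
    eventually_mul_lt (c := Λp * (ΓL + τ * Γ)) (half_pos hτ0),
    eventually_mul_lt (c := max Gm Gp) hδ, self_mem_nhdsWithin] with ε hsub em ep eG hε z hz hx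
  have hε : 0 < ε := hε
  have hzL : z ∈ lateralDataDomain Ω := ⟨hx, (hsub hz).2⟩
  have hzδ : |z.2| < δ := (abs_snd_le_of_mem_slab (G := max Gm Gp)
    (fun x hx => (hGm x hx).trans (le_max_left _ _))
    (fun x hx => (hGp x hx).trans (le_max_right _ _)) hε hz).trans_lt (by linarith)
  have hγs := abs_lt.1 (hsm z hzL hzδ)
  have hin : ∀ v, 0 < fderiv ℝ ρ z.1 v → ∀ᶠ h : ℝ in 𝓝[>] 0, z.1 - h • v ∈ Ω := by
    intro v hv
    have h1 := eventually_neg_of_fderiv_pos (hρ.differentiable one_ne_zero z.1)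
      (hρΩ z.1 hx).1.le (fun _ => hv)
    have hcv : Continuous fun h : ℝ => z.1 - h • v := by fun_prop
    have hcv' : Tendsto (fun h : ℝ => z.1 - h • v) (𝓝[>] 0) (𝓝 z.1) := by
      simpa using (hcv.tendsto 0).mono_left (nhdsWithin_le_nhds (s := Ioi (0 : ℝ)))
    filter_upwards [h1, hcv'.eventually (hρΩ z.1 hx).2] with h h1 h2 using h2 h1
  have hcomb : ∀ g : Pt N, ‖g‖ ≤ Γ → 0 < fderiv ℝ ρ z.1 (γ z + τ • g).1 := by
    intro g hgΓ
    have h1 := abs_le.1 (abs_apply_le (hP z.1 hz.1) ((norm_fst_le g).trans hgΓ))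
    have h2 : (γ z + τ • g).1 = (γ z).1 + τ • g.1 := rfl
    rw [h2, map_add, map_smul, smul_eq_mul]
    nlinarith [hρκ z hzL, h1.1]
  have hnorm : ∀ g : Pt N, ‖g‖ ≤ Γ → ‖(γ z + τ • g).1‖ ≤ ΓL + τ * Γ := by
    intro g hgΓ
    refine (norm_fst_le _).trans ((norm_add_le _ _).trans ?_)
    rw [norm_smul, Real.norm_of_nonneg hτ0.le]
    have := mul_le_mul_of_nonneg_left hgΓ hτ0.le
    linarith [hΓL z hzL]
  have hm := (hΓm z (hsub hz)).trans (le_max_left Γm Γp)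
  have hp := (hΓp z (hsub hz)).trans (le_max_right Γm Γp)
  refine ⟨fun h1 h2 => ?_, fun hzg => ?_, fun hzg => ?_⟩
  · exact pointsInto_thin hgm' hgme hgp' hgpe hz (hin _ (hκ.trans_le (hρκ z hzL)))
      (fun h => absurd h h1) (fun h => absurd h h2)
  · refine pointsInto_thin hgm' hgme hgp' hgpe hz (hin _ (hcomb _ hm)) (fun _ => ?_) (fun h => ?_)
    · have := abs_le.1 (abs_apply_le (hΛm z.1 hz.1) (hnorm _ hm))
      have h2 : (γ z + τ • γm z).2 = (γ z).2 + τ * (γm z).2 := rfl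
      rw [h2, hγm2 z (hsub hz)]
      nlinarith [this.1]
    · exact absurd (hzg.symm.trans h) (mul_lt_mul_of_pos_left (hg z.1 hz.1) hε).ne
  · refine pointsInto_thin hgm' hgme hgp' hgpe hz (hin _ (hcomb _ hp)) (fun h => ?_) (fun _ => ?_)
    · exact absurd (h.symm.trans hzg) (mul_lt_mul_of_pos_left (hg z.1 hz.1) hε).ne
    · have := abs_le.1 (abs_apply_le (hΛp z.1 hz.1) (hnorm _ hp))
      have h2 : (γ z + τ • γp z).2 = (γ z).2 + τ * (γp z).2 := rfl
      rw [h2, hγp2 z (hsub hz)]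
      nlinarith [this.2]

end Inward

/-! ### The viscosity inequalities of the thin-domain problem -/

/-- The generalized boundary value inequality at `z`: the equation, or one of the boundary conditions
active at `z`, holds as `≤ 0`. The operators on the lateral set, bottom and top are `Lat`, `Bot`,
`Tp`. -/
def BdryIneq {N : ℕ} (L S T : Set (Pt N)) (F : Mat N → Pt N → ℝ → Pt N → ℝ)
    (Lat : Pt N → ℝ → Pt N → ℝ) (Bot Tp : Pt N → Pt N → ℝ)
    (X : Mat N) (p : Pt N) (r : ℝ) (z : Pt N) : Prop :=
  F X p r z ≤ 0 ∨ (z ∈ L ∧ Lat p r z ≤ 0) ∨ (z ∈ S ∧ Bot p z ≤ 0) ∨ (z ∈ T ∧ Tp p z ≤ 0)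

theorem not_bdryIneq {N : ℕ} {L S T : Set (Pt N)} {F : Mat N → Pt N → ℝ → Pt N → ℝ}
    {Lat : Pt N → ℝ → Pt N → ℝ} {Bot Tp : Pt N → Pt N → ℝ} {X : Mat N} {p : Pt N} {r : ℝ}
    {z : Pt N} : ¬ BdryIneq L S T F Lat Bot Tp X p r z ↔
      0 < F X p r z ∧ (z ∈ L → 0 < Lat p r z) ∧ (z ∈ S → 0 < Bot p z) ∧ (z ∈ T → 0 < Tp p z) := by
  simp only [BdryIneq, not_or, not_and, not_le]

theorem eventually_imp_pos {N : ℕ} {L : Set (Pt N)} (hL : IsClosed L) {g : Pt N × ℝ → ℝ}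
    (hg : ContinuousOn g (L ×ˢ univ)) {z : Pt N} {r : ℝ} (h : z ∈ L → 0 < g (z, r)) :
    ∀ᶠ q in 𝓝 (z, r), q.1 ∈ L → 0 < g q := by
  by_cases hz : z ∈ L
  · have h1 := (hg (z, r) ⟨hz, trivial⟩).eventually (Ioi_mem_nhds (h hz))
    filter_upwards [eventually_nhdsWithin_iff.1 h1] with q hq hqL using hq ⟨hqL, trivial⟩
  · filter_upwards [continuous_fst.continuousAt.eventually (hL.isOpen_compl.mem_nhds hz)]
      with q hq hqL using absurd hqL hq

theorem isClosedAlongJets_bdryIneq {N : ℕ} {K L S T : Set (Pt N)} (hK : IsClosed K)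
    (hL : IsClosed L) (hS : IsClosed S) (hT : IsClosed T) {F : Mat N → Pt N → ℝ → Pt N → ℝ}
    {Lat : Pt N → ℝ → Pt N → ℝ} {Bot Tp : Pt N → Pt N → ℝ}
    (hF : ∀ φ : Pt N → ℝ, ContDiff ℝ 2 φ →
      ContinuousOn (fun q : Pt N × ℝ => F (hess φ q.1) (grad φ q.1) q.2 q.1) (K ×ˢ univ))
    (hLat : ∀ φ : Pt N → ℝ, ContDiff ℝ 2 φ →
      ContinuousOn (fun q : Pt N × ℝ => Lat (grad φ q.1) q.2 q.1) (L ×ˢ univ))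
    (hBot : ∀ φ : Pt N → ℝ, ContDiff ℝ 2 φ → ContinuousOn (fun z => Bot (grad φ z) z) S)
    (hTp : ∀ φ : Pt N → ℝ, ContDiff ℝ 2 φ → ContinuousOn (fun z => Tp (grad φ z) z) T) :
    IsClosedAlongJets K (BdryIneq L S T F Lat Bot Tp) := by
  intro φ hφ z hz r hn
  obtain ⟨h1, h2, h3, h4⟩ := not_bdryIneq.1 hn
  have hprod : ∀ {s : Set (Pt N)} {g : Pt N → ℝ}, ContinuousOn g s →
      ContinuousOn (fun q : Pt N × ℝ => g q.1) (s ×ˢ univ) := fun hg =>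
    hg.comp continuousOn_fst fun q hq => hq.1
  have e1 := eventually_imp_pos hK (hF φ hφ) (r := r) fun _ : z ∈ K => h1
  have e2 := eventually_imp_pos hL (hLat φ hφ) (r := r) h2
  have e3 := eventually_imp_pos hS (hprod (hBot φ hφ)) (r := r) h3
  have e4 := eventually_imp_pos hT (hprod (hTp φ hφ)) (r := r) h4
  have hle : 𝓝[K] z ×ˢ 𝓝 r ≤ 𝓝 (z, r) := by
    rw [nhds_prod_eq]; exact prod_mono nhdsWithin_le_nhds le_rfl
  have hKev : ∀ᶠ q in 𝓝[K] z ×ˢ 𝓝 r, q.1 ∈ K :=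
    tendsto_fst.eventually (self_mem_nhdsWithin : K ∈ 𝓝[K] z)
  filter_upwards [hle e1, hle e2, hle e3, hle e4, hKev] with q e1 e2 e3 e4 hq
  exact not_bdryIneq.2 ⟨e1 hq, e2, e3, e4⟩

theorem six_cases_iff {α : Type*} {z : α} {D L S T : Set α}
    (hcov : z ∈ D ∨ z ∈ L ∨ z ∈ S ∨ z ∈ T)
    (hD : z ∈ D → z ∉ L ∧ z ∉ S ∧ z ∉ T) (hST : ¬ (z ∈ S ∧ z ∈ T)) (e l b t : Prop) :
    ((z ∈ D → e) ∧ (z ∈ L \ (S ∪ T) → e ∨ l) ∧ (z ∈ S \ L → e ∨ b) ∧ (z ∈ T \ L → e ∨ t) ∧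
      (z ∈ L ∩ S → e ∨ l ∨ b) ∧ (z ∈ L ∩ T → e ∨ l ∨ t)) ↔
    (e ∨ (z ∈ L ∧ l) ∨ (z ∈ S ∧ b) ∨ (z ∈ T ∧ t)) := by
  by_cases hL : z ∈ L <;> by_cases hS : z ∈ S <;> by_cases hT : z ∈ T <;>
    by_cases hDz : z ∈ D <;> simp_all

theorem closure_thin_subset_slab {N : ℕ} {Ω : Set (Base N)} {gm gp : Base N → ℝ}
    (hgm : IsC1On gm (closure Ω)) (hgp : IsC1On gp (closure Ω)) (ε : ℝ) :
    closure (thin Ω gm gp ε) ⊆ slab Ω gm gp ε := by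
  obtain ⟨gm', hgm', hm⟩ := hgm
  obtain ⟨gp', hgp', hp⟩ := hgp
  have e : slab Ω gm gp ε = {z : Pt N | z.1 ∈ closure Ω} ∩
      ({z | ε * gm' z.1 ≤ z.2} ∩ {z | z.2 ≤ ε * gp' z.1}) := by
    ext z
    refine ⟨fun h => ⟨h.1, ?_, ?_⟩, fun h => ⟨h.1, ?_, ?_⟩⟩
    · rw [mem_ofPred_eq, ← hm h.1]; exact h.2.1
    · rw [mem_ofPred_eq, ← hp h.1]; exact h.2.2
    · rw [hm h.1]; exact h.2.1
    · rw [hp h.1]; exact h.2.2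
  have h1 := hgm'.continuous
  have h2 := hgp'.continuous
  have hcl : IsClosed (slab Ω gm gp ε) := by
    rw [e]
    refine (isClosed_closure.preimage continuous_fst).inter (IsClosed.inter ?_ ?_)
    · exact isClosed_le (by fun_prop) continuous_snd
    · exact isClosed_le continuous_snd (by fun_prop)
  exact closure_minimal (fun z hz => ⟨subset_closure hz.1, hz.2.1.le, hz.2.2.le⟩) hcl

theorem isOpen_thin {N : ℕ} {Ω : Set (Base N)} (hΩ : IsOpen Ω) {gm gp : Base N → ℝ}
    (hgm : IsC1On gm (closure Ω)) (hgp : IsC1On gp (closure Ω)) (ε : ℝ) :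
    IsOpen (thin Ω gm gp ε) := by
  obtain ⟨gm', hgm', hm⟩ := hgm
  obtain ⟨gp', hgp', hp⟩ := hgp
  have e : thin Ω gm gp ε = {z : Pt N | z.1 ∈ Ω} ∩
      ({z | ε * gm' z.1 < z.2} ∩ {z | z.2 < ε * gp' z.1}) := by
    ext z
    refine ⟨fun h => ⟨h.1, ?_, ?_⟩, fun h => ⟨h.1, ?_, ?_⟩⟩
    · rw [mem_ofPred_eq, ← hm (subset_closure h.1)]; exact h.2.1
    · rw [mem_ofPred_eq, ← hp (subset_closure h.1)]; exact h.2.2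
    · rw [hm (subset_closure h.1)]; exact h.2.1
    · rw [hp (subset_closure h.1)]; exact h.2.2
  have h1 := hgm'.continuous
  have h2 := hgp'.continuous
  rw [e]
  refine (hΩ.preimage continuous_fst).inter (IsOpen.inter ?_ ?_)
  · exact isOpen_lt (by fun_prop) continuous_snd
  · exact isOpen_lt continuous_snd (by fun_prop)

theorem isClosed_graph_over {N : ℕ} {s : Set (Base N)} (hs : IsClosed s) {g : Base N → ℝ}
    (hg : IsC1On g s) (ε : ℝ) : IsClosed {z : Pt N | z.1 ∈ s ∧ z.2 = ε * g z.1} := by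
  obtain ⟨g', hg', h⟩ := hg
  have e : {z : Pt N | z.1 ∈ s ∧ z.2 = ε * g z.1} =
      {z : Pt N | z.1 ∈ s} ∩ {z | z.2 = ε * g' z.1} := by
    ext z
    refine ⟨fun hz => ⟨hz.1, ?_⟩, fun hz => ⟨hz.1, ?_⟩⟩
    · rw [mem_ofPred_eq, ← h hz.1]; exact hz.2
    · rw [h hz.1]; exact hz.2
  have := hg'.continuous
  rw [e]
  exact (hs.preimage continuous_fst).inter (isClosed_eq continuous_snd (by fun_prop))

theorem isClosed_lateral {N : ℕ} {Ω : Set (Base N)} {gm gp : Base N → ℝ}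
    (hgm : IsC1On gm (closure Ω)) (hgp : IsC1On gp (closure Ω)) (ε : ℝ) :
    IsClosed (lateral Ω gm gp ε) := by
  obtain ⟨gm', hgm', hm⟩ := hgm
  obtain ⟨gp', hgp', hp⟩ := hgp
  have e : lateral Ω gm gp ε = {z : Pt N | z.1 ∈ frontier Ω} ∩
      ({z | ε * gm' z.1 ≤ z.2} ∩ {z | z.2 ≤ ε * gp' z.1}) := by
    ext z
    refine ⟨fun h => ⟨h.1, ?_, ?_⟩, fun h => ⟨h.1, ?_, ?_⟩⟩
    · rw [mem_ofPred_eq, ← hm (frontier_subset_closure h.1)]; exact h.2.1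
    · rw [mem_ofPred_eq, ← hp (frontier_subset_closure h.1)]; exact h.2.2
    · rw [hm (frontier_subset_closure h.1)]; exact h.2.1
    · rw [hp (frontier_subset_closure h.1)]; exact h.2.2
  have h1 := hgm'.continuous
  have h2 := hgp'.continuous
  rw [e]
  refine (isClosed_frontier.preimage continuous_fst).inter (IsClosed.inter ?_ ?_)
  · exact isClosed_le (by fun_prop) continuous_snd
  · exact isClosed_le continuous_snd (by fun_prop)

section Problem

variable {N : ℕ} {Ω : Set (Base N)} {gm gp : Base N → ℝ} {ε : ℝ}
  {F : Mat N → Pt N → ℝ → Pt N → ℝ} {γm γp : Pt N → Pt N} {βm βp : Pt N → ℝ}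
  {B : Pt N → ℝ → Pt N → ℝ}

variable (Ω gm gp ε F γm γp βm βp B) in
/-- The inequality of subsolutions of the thin-domain problem. -/
def SubIneq : Mat N → Pt N → ℝ → Pt N → Prop :=
  BdryIneq (lateral Ω gm gp ε) (bottom Ω gm ε) (top Ω gp ε) F B
    (fun p z => dot (γm z) p - βm z) (fun p z => dot (γp z) p - βp z)

variable (Ω gm gp ε F γm γp βm βp B) in
/-- The inequality of supersolutions, written as `≤ 0` for the operators with opposite signs. -/
def SuperIneq : Mat N → Pt N → ℝ → Pt N → Prop :=
  BdryIneq (lateral Ω gm gp ε) (bottom Ω gm ε) (top Ω gp ε) (fun X p r z => -F X p r z)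
    (fun p r z => -B p r z) (fun p z => -(dot (γm z) p - βm z))
    (fun p z => -(dot (γp z) p - βp z))

theorem boundary_cases (hΩ : IsOpen Ω) (hg : ∀ x ∈ closure Ω, gm x < gp x) (hε : 0 < ε)
    {z : Pt N} (hz : z ∈ slab Ω gm gp ε) :
    (z ∈ thin Ω gm gp ε ∨ z ∈ lateral Ω gm gp ε ∨ z ∈ bottom Ω gm ε ∨ z ∈ top Ω gp ε) ∧
    (z ∈ thin Ω gm gp ε → z ∉ lateral Ω gm gp ε ∧ z ∉ bottom Ω gm ε ∧ z ∉ top Ω gp ε) ∧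
    ¬ (z ∈ bottom Ω gm ε ∧ z ∈ top Ω gp ε) := by
  refine ⟨?_, fun h => ⟨fun h' => ?_, fun h' => h.2.1.ne' h'.2, fun h' => h.2.2.ne h'.2⟩,
    fun h => ?_⟩
  · by_cases hx : z.1 ∈ Ω
    · rcases hz.2.1.lt_or_eq with h1 | h1
      · rcases hz.2.2.lt_or_eq with h2 | h2
        · exact Or.inl ⟨hx, h1, h2⟩
        · exact Or.inr (Or.inr (Or.inr ⟨hz.1, h2⟩))
      · exact Or.inr (Or.inr (Or.inl ⟨hz.1, h1.symm⟩))
    · exact Or.inr (Or.inl ⟨by rw [hΩ.frontier_eq]; exact ⟨hz.1, hx⟩, hz.2⟩)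
  · have := h'.1
    rw [hΩ.frontier_eq] at this
    exact this.2 h.1
  · exact (mul_lt_mul_of_pos_left (hg z.1 hz.1) hε).ne (h.1.2.symm.trans h.2.2)

theorem isViscositySubsolution_iff (hΩ : IsOpen Ω) (hgm : IsC1On gm (closure Ω))
    (hgp : IsC1On gp (closure Ω)) (hg : ∀ x ∈ closure Ω, gm x < gp x) (hε : 0 < ε)
    {u : Pt N → ℝ} :
    IsViscositySubsolution Ω gm gp ε F γm γp βm βp B u ↔
      IsBddOn (closure (thin Ω gm gp ε)) u ∧ IsSub (closure (thin Ω gm gp ε))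
        (SubIneq Ω gm gp ε F γm γp βm βp B) (uscEnv (closure (thin Ω gm gp ε)) u) := by
  refine and_congr_right fun hu => (Iff.trans ?_ (and_iff_right
    (upperSemicontinuousOn_uscEnv hu)).symm)
  refine forall_congr' fun φ => imp_congr_right fun _ => forall_congr' fun z =>
    forall_congr' fun hz => imp_congr_right fun _ => ?_
  obtain ⟨h1, h2, h3⟩ := boundary_cases hΩ hg hε (closure_thin_subset_slab hgm hgp ε hz)
  simp only [SubIneq, BdryIneq, sub_nonpos]
  exact six_cases_iff h1 h2 h3 _ _ _ _

theorem isViscositySupersolution_iff (hΩ : IsOpen Ω) (hgm : IsC1On gm (closure Ω))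
    (hgp : IsC1On gp (closure Ω)) (hg : ∀ x ∈ closure Ω, gm x < gp x) (hε : 0 < ε)
    {u : Pt N → ℝ} :
    IsViscositySupersolution Ω gm gp ε F γm γp βm βp B u ↔
      IsBddOn (closure (thin Ω gm gp ε)) u ∧ IsSuper (closure (thin Ω gm gp ε))
        (SuperIneq Ω gm gp ε F γm γp βm βp B) (lscEnv (closure (thin Ω gm gp ε)) u) := by
  refine and_congr_right fun hu => (Iff.trans ?_ (and_iff_right
    (lowerSemicontinuousOn_lscEnv hu)).symm)
  refine forall_congr' fun φ => imp_congr_right fun _ => forall_congr' fun z =>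
    forall_congr' fun hz => imp_congr_right fun _ => ?_
  obtain ⟨h1, h2, h3⟩ := boundary_cases hΩ hg hε (closure_thin_subset_slab hgm hgp ε hz)
  simp only [SuperIneq, BdryIneq, neg_nonpos, sub_nonneg]
  exact six_cases_iff h1 h2 h3 _ _ _ _

theorem continuousOn_dot_grad {s : Set (Pt N)} {γ : Pt N → Pt N} (hγ : ContinuousOn γ s)
    {φ : Pt N → ℝ} (hφ : ContDiff ℝ 2 φ) : ContinuousOn (fun z => dot (γ z) (grad φ z)) s := by
  simp only [dot_grad]
  exact (contDiff_one_fderiv hφ).continuous.continuousOn.clm_apply hγ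

theorem IsLateralOp.continuousOn (hB : IsLateralOp Ω B) {φ : Pt N → ℝ} (hφ : ContDiff ℝ 2 φ) :
    ContinuousOn (fun q : Pt N × ℝ => B (grad φ q.1) q.2 q.1) (lateralDataDomain Ω ×ˢ univ) := by
  have hfst : MapsTo (Prod.fst : Pt N × ℝ → Pt N) (lateralDataDomain Ω ×ˢ univ)
      (lateralDataDomain Ω) := fun q hq => hq.1
  rcases hB with ⟨γ, β, hγ, hβ, -, -, rfl⟩ | ⟨β, hβ, rfl⟩
  · exact ((continuousOn_dot_grad hγ hφ).sub hβ).comp continuousOn_fst hfst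
  · exact continuousOn_snd.sub (hβ.comp continuousOn_fst hfst)

theorem IsProperElliptic.continuousOn (hF : IsProperElliptic Ω F) {φ : Pt N → ℝ}
    (hφ : ContDiff ℝ 2 φ) :
    ContinuousOn (fun q : Pt N × ℝ => F (hess φ q.1) (grad φ q.1) q.2 q.1)
      (dataDomain Ω ×ˢ univ) := by
  have h1 : Continuous fun q : Pt N × ℝ => (hess φ q.1, grad φ q.1, q.2, q.1) :=
    ((continuous_hess hφ).comp continuous_fst).prodMk
      (((continuous_grad hφ).comp continuous_fst).prodMk (continuous_snd.prodMk continuous_fst))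
  exact hF.1.comp h1.continuousOn fun q hq => ⟨hess_isSymm hφ _, hq.1⟩

theorem isClosedAlongJets_subIneq_superIneq (hgm : IsC1On gm (closure Ω))
    (hgp : IsC1On gp (closure Ω)) (hF : IsProperElliptic Ω F) (hB : IsLateralOp Ω B)
    (hγm : ContinuousOn γm (dataDomain Ω)) (hγp : ContinuousOn γp (dataDomain Ω))
    (hβm : ContinuousOn βm (dataDomain Ω)) (hβp : ContinuousOn βp (dataDomain Ω))
    (hg : ∀ x ∈ closure Ω, gm x < gp x) (hε : 0 < ε) (hsub : slab Ω gm gp ε ⊆ dataDomain Ω) :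
    IsClosedAlongJets (closure (thin Ω gm gp ε)) (SubIneq Ω gm gp ε F γm γp βm βp B) ∧
    IsClosedAlongJets (closure (thin Ω gm gp ε)) (SuperIneq Ω gm gp ε F γm γp βm βp B) := by
  have hK : closure (thin Ω gm gp ε) ⊆ dataDomain Ω :=
    (closure_thin_subset_slab hgm hgp ε).trans hsub
  have hS : bottom Ω gm ε ⊆ dataDomain Ω := fun z hz => hsub ⟨hz.1, hz.2.ge,
    by rw [hz.2]; exact mul_le_mul_of_nonneg_left (hg z.1 hz.1).le hε.le⟩
  have hT : top Ω gp ε ⊆ dataDomain Ω := fun z hz => hsub ⟨hz.1,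
    by rw [hz.2]; exact mul_le_mul_of_nonneg_left (hg z.1 hz.1).le hε.le, hz.2.le⟩
  have hL : lateral Ω gm gp ε ⊆ lateralDataDomain Ω := fun z hz =>
    ⟨hz.1, (hsub ⟨frontier_subset_closure hz.1, hz.2⟩).2⟩
  have cF : ∀ φ : Pt N → ℝ, ContDiff ℝ 2 φ → ContinuousOn (fun q : Pt N × ℝ =>
      F (hess φ q.1) (grad φ q.1) q.2 q.1) (closure (thin Ω gm gp ε) ×ˢ univ) := fun φ hφ =>
    (hF.continuousOn hφ).mono (prod_mono hK subset_rfl)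
  have cB : ∀ φ : Pt N → ℝ, ContDiff ℝ 2 φ → ContinuousOn (fun q : Pt N × ℝ =>
      B (grad φ q.1) q.2 q.1) (lateral Ω gm gp ε ×ˢ univ) := fun φ hφ =>
    (hB.continuousOn hφ).mono (prod_mono hL subset_rfl)
  have cS : ∀ φ : Pt N → ℝ, ContDiff ℝ 2 φ →
      ContinuousOn (fun z => dot (γm z) (grad φ z) - βm z) (bottom Ω gm ε) := fun φ hφ =>
    (continuousOn_dot_grad (hγm.mono hS) hφ).sub (hβm.mono hS)
  have cT : ∀ φ : Pt N → ℝ, ContDiff ℝ 2 φ →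
      ContinuousOn (fun z => dot (γp z) (grad φ z) - βp z) (top Ω gp ε) := fun φ hφ =>
    (continuousOn_dot_grad (hγp.mono hT) hφ).sub (hβp.mono hT)
  have k1 := isClosed_lateral hgm hgp ε
  have k2 := isClosed_graph_over isClosed_closure hgm ε
  have k3 := isClosed_graph_over isClosed_closure hgp ε
  exact ⟨isClosedAlongJets_bdryIneq isClosed_closure k1 k2 k3 cF cB cS cT,
    isClosedAlongJets_bdryIneq isClosed_closure k1 k2 k3 (fun φ hφ => (cF φ hφ).neg)
      (fun φ hφ => (cB φ hφ).neg) (fun φ hφ => (cS φ hφ).neg) (fun φ hφ => (cT φ hφ).neg)⟩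

theorem dot_grad_le_of_pointsInto {K : Set (Pt N)} {φ χ : Pt N → ℝ} (hφ : ContDiff ℝ 2 φ)
    (hχ : ContDiff ℝ 2 χ) {z d : Pt N} (hmax : IsLocalMaxOn (fun w => φ w - χ w) K z)
    (hd : PointsInto K z d) : dot d (grad χ z) ≤ dot d (grad φ z) := by
  have h1 := fderiv_nonneg_of_pointsInto ((hφ.sub hχ).differentiable (by norm_num) z) hmax hd
  have h2 : fderiv ℝ (fun w => φ w - χ w) z = fderiv ℝ φ z - fderiv ℝ χ z :=
    fderiv_fun_sub (hφ.differentiable (by norm_num) z) (hχ.differentiable (by norm_num) z)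
  have h3 : 0 ≤ (fderiv ℝ φ z - fderiv ℝ χ z) d := by rw [← h2]; exact h1
  rw [sub_apply] at h3
  rw [dot_grad, dot_grad]
  linarith

/-- A classical strict subsolution `φ` passes the inequality of subsolutions to each test function
`χ` touching it from above: in the interior by ellipticity, and on the boundary because `φ - χ` is
nondecreasing along some direction in the cone spanned by the active oblique vectors. -/
theorem subIneq_of_touching (hΩ : IsOpen Ω)
    (hgm : IsC1On gm (closure Ω)) (hgp : IsC1On gp (closure Ω))
    (hF : IsProperElliptic Ω F) (hsub : slab Ω gm gp ε ⊆ dataDomain Ω)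
    (hTB : ∀ z ∈ slab Ω gm gp ε, z.1 ∈ Ω →
      (z.2 = ε * gm z.1 → PointsInto (thin Ω gm gp ε) z (γm z)) ∧
      (z.2 = ε * gp z.1 → PointsInto (thin Ω gm gp ε) z (γp z)))
    (hlat : (∃ β, B = dirichletOp β) ∨ ∃ γ β, ∃ τ : ℝ, B = obliqueOp γ β ∧ 0 < τ ∧
      ∀ z ∈ slab Ω gm gp ε, z.1 ∈ frontier Ω →
      (z.2 ≠ ε * gm z.1 → z.2 ≠ ε * gp z.1 → PointsInto (thin Ω gm gp ε) z (γ z)) ∧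
      (z.2 = ε * gm z.1 → PointsInto (thin Ω gm gp ε) z (γ z + τ • γm z)) ∧
      (z.2 = ε * gp z.1 → PointsInto (thin Ω gm gp ε) z (γ z + τ • γp z)))
    {φ χ : Pt N → ℝ} (hφ : ContDiff ℝ 2 φ) (hχ : ContDiff ℝ 2 χ) {z : Pt N}
    (hz : z ∈ closure (thin Ω gm gp ε))
    (hmax : IsLocalMaxOn (fun w => φ w - χ w) (closure (thin Ω gm gp ε)) z)
    (hn : ¬ SuperIneq Ω gm gp ε F γm γp βm βp B (hess φ z) (grad φ z) (φ z) z) :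
    SubIneq Ω gm gp ε F γm γp βm βp B (hess χ z) (grad χ z) (φ z) z := by
  obtain ⟨n1, n2, n3, n4⟩ := not_bdryIneq.1 hn
  simp only [neg_pos] at n1 n2 n3 n4
  have hzs := closure_thin_subset_slab hgm hgp ε hz
  have hdir : ∀ {d}, PointsInto (thin Ω gm gp ε) z d → dot d (grad χ z) ≤ dot d (grad φ z) :=
    fun hd => dot_grad_le_of_pointsInto hφ hχ hmax (hd.mono fun _ h => subset_closure h)
  have hadd : ∀ (a b p : Pt N) (t : ℝ), dot (a + t • b) p = dot a p + t * dot b p := by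
    intro a b p t
    simp only [dot, Prod.fst_add, Prod.snd_add, Prod.smul_fst, Prod.smul_snd, inner_add_left,
      real_inner_smul_left, smul_eq_mul]
    ring
  by_cases hL : z ∈ lateral Ω gm gp ε
  · rcases hlat with ⟨β, rfl⟩ | ⟨γ, β, τ, rfl, hτ, hlat⟩
    · exact Or.inr (Or.inl ⟨hL, (n2 hL).le⟩)
    obtain ⟨l1, l2, l3⟩ := hlat z hzs hL.1
    have hlow := n2 hL
    simp only [obliqueOp] at hlow
    by_cases hzm : z.2 = ε * gm z.1
    · have h1 := hdir (l2 hzm)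
      rw [hadd, hadd] at h1
      have h2 := n3 ⟨hzs.1, hzm⟩
      by_contra hcon
      obtain ⟨-, c2, c3, -⟩ := not_bdryIneq.1 hcon
      have c2 := c2 hL
      have c3 := c3 ⟨hzs.1, hzm⟩
      simp only [obliqueOp] at c2
      have := mul_lt_mul_of_pos_left (h2.trans c3) hτ
      linarith
    by_cases hzp : z.2 = ε * gp z.1
    · have h1 := hdir (l3 hzp)
      rw [hadd, hadd] at h1
      have h2 := n4 ⟨hzs.1, hzp⟩
      by_contra hcon
      obtain ⟨-, c2, -, c3⟩ := not_bdryIneq.1 hcon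
      have c2 := c2 hL
      have c3 := c3 ⟨hzs.1, hzp⟩
      simp only [obliqueOp] at c2
      have := mul_lt_mul_of_pos_left (h2.trans c3) hτ
      linarith
    have h1 := hdir (l1 hzm hzp)
    refine Or.inr (Or.inl ⟨hL, ?_⟩)
    simp only [obliqueOp]
    linarith
  · have hx : z.1 ∈ Ω := by
      by_contra hx
      exact hL ⟨by rw [hΩ.frontier_eq]; exact ⟨hzs.1, hx⟩, hzs.2⟩
    obtain ⟨t1, t2⟩ := hTB z hzs hx
    by_cases hzm : z.2 = ε * gm z.1
    · have h1 := hdir (t1 hzm)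
      have h2 := n3 ⟨hzs.1, hzm⟩
      exact Or.inr (Or.inr (Or.inl ⟨⟨hzs.1, hzm⟩, by linarith⟩))
    by_cases hzp : z.2 = ε * gp z.1
    · have h1 := hdir (t2 hzp)
      have h2 := n4 ⟨hzs.1, hzp⟩
      exact Or.inr (Or.inr (Or.inr ⟨⟨hzs.1, hzp⟩, by linarith⟩))
    have hthin : z ∈ thin Ω gm gp ε :=
      ⟨hx, lt_of_le_of_ne hzs.2.1 (Ne.symm hzm), lt_of_le_of_ne hzs.2.2 hzp⟩
    have hloc : IsLocalMax (fun w => φ w - χ w) z := hmax.isLocalMax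
      (mem_of_superset ((isOpen_thin hΩ hgm hgp ε).mem_nhds hthin) subset_closure)
    have hgrad : grad φ z = grad χ z := by
      have h0 : fderiv ℝ (fun w => φ w - χ w) z = 0 := hloc.fderiv_eq_zero
      rw [fderiv_fun_sub (hφ.differentiable (by norm_num) z)
        (hχ.differentiable (by norm_num) z), sub_eq_zero] at h0
      simp only [grad, h0]
    obtain ⟨-, α, -, hmono⟩ := hF
    have h1 := hmono (grad χ z) z (hsub hzs) _ _ (hess_isSymm hχ z) (hess_isSymm hφ z)
      (posSemidef_hess_sub hφ hχ hloc) (φ z) (φ z) le_rfl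
    rw [← hgrad] at h1
    refine Or.inl ?_
    rw [← hgrad]
    linarith

theorem IsProperElliptic.mono_right (hF : IsProperElliptic Ω F) {X : Mat N} (hX : X.IsSymm)
    (p : Pt N) {z : Pt N} (hz : z ∈ dataDomain Ω) {r s : ℝ} (hrs : r ≤ s) :
    F X p r z ≤ F X p s z := by
  obtain ⟨-, α, hα, hmono⟩ := hF
  have h1 := hmono p z hz X X hX hX (by simpa using Matrix.PosSemidef.zero) r s hrs
  nlinarith

theorem IsLateralOp.mono_right (hB : IsLateralOp Ω B) (p z : Pt N) {r s : ℝ} (hrs : r ≤ s) :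
    B p r z ≤ B p s z := by
  rcases hB with ⟨γ, β, -, -, -, -, rfl⟩ | ⟨β, -, rfl⟩
  · exact le_rfl
  · exact sub_le_sub_right hrs _

/-! ### Reflection of the data -/

/-- The change of unknown `u ↦ -u` exchanges sub- and supersolutions and keeps the assumptions. -/
theorem IsProperElliptic.reflect (hF : IsProperElliptic Ω F) :
    IsProperElliptic Ω fun X p r z => -F (-X) (-p) (-r) z := by
  obtain ⟨hc, α, hα, hmono⟩ := hF
  refine ⟨?_, α, hα, fun p z hz X Y hX hY hXY r s hrs => ?_⟩
  · have h1 : Continuous fun q : Mat N × Pt N × ℝ × Pt N => (-q.1, -q.2.1, -q.2.2.1, q.2.2.2) := by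
      fun_prop
    exact (hc.comp h1.continuousOn fun q hq => ⟨hq.1.neg, hq.2⟩).neg
  · have := hmono (-p) z hz (-Y) (-X) hY.neg hX.neg (by rwa [neg_sub_neg]) (-s) (-r)
      (neg_le_neg hrs)
    linarith

theorem dot_neg (a p : Pt N) : dot a (-p) = -dot a p := by
  simp [dot]; ring

theorem IsLateralOp.reflect (hB : IsLateralOp Ω B) :
    IsLateralOp Ω fun p r z => -B (-p) (-r) z := by
  rcases hB with ⟨γ, β, hγ, hβ, h1, h2, rfl⟩ | ⟨β, hβ, rfl⟩
  · refine Or.inl ⟨γ, fun z => -β z, hγ, hβ.neg, h1, h2, ?_⟩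
    funext p r z
    simp only [obliqueOp, dot_neg]; ring
  · refine Or.inr ⟨fun z => -β z, hβ.neg, ?_⟩
    funext p r z
    simp only [dirichletOp]; ring

end Problem

end ThinDomain

end

theorem proposition3p1 {N : ℕ}
    (Ω : Set (ThinDomain.Base N)) (hΩo : IsOpen Ω) (hΩb : Bornology.IsBounded Ω)
    (hΩ1 : ThinDomain.HasC1Boundary Ω)
    (gm gp : ThinDomain.Base N → ℝ)
    (hgm : ThinDomain.IsC1On gm (closure Ω)) (hgp : ThinDomain.IsC1On gp (closure Ω))
    (hg : ∀ x ∈ closure Ω, gm x < gp x)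
    (F : ThinDomain.Mat N → ThinDomain.Pt N → ℝ → ThinDomain.Pt N → ℝ)
    (hF : ThinDomain.IsProperElliptic Ω F)
    (γm γp : ThinDomain.Pt N → ThinDomain.Pt N) (βm βp : ThinDomain.Pt N → ℝ)
    (hγm : ContinuousOn γm (ThinDomain.dataDomain Ω))
    (hγp : ContinuousOn γp (ThinDomain.dataDomain Ω))
    (hβm : ContinuousOn βm (ThinDomain.dataDomain Ω))
    (hβp : ContinuousOn βp (ThinDomain.dataDomain Ω))
    (hγm2 : ∀ z ∈ ThinDomain.dataDomain Ω, (γm z).2 = -1)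
    (hγp2 : ∀ z ∈ ThinDomain.dataDomain Ω, (γp z).2 = 1)
    (γo : ThinDomain.Base N → ThinDomain.Base N) (βo : ThinDomain.Base N → ℝ)
    (hβop : ∀ x ∈ closure Ω, βp (x, 0) = βo x) (hβom : ∀ x ∈ closure Ω, -βm (x, 0) = βo x)
    (hγop : ∀ x ∈ closure Ω, (γp (x, 0)).1 = γo x)
    (hγom : ∀ x ∈ closure Ω, -(γm (x, 0)).1 = γo x)
    (hβo : ThinDomain.IsC1On βo (closure Ω)) (hγo : ThinDomain.IsC1On γo (closure Ω))
    (km kp : ThinDomain.Base N → ThinDomain.Base N) (lm lp : ThinDomain.Base N → ℝ)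
    (hkm : ContinuousOn km (closure Ω)) (hkp : ContinuousOn kp (closure Ω))
    (hlm : ContinuousOn lm (closure Ω)) (hlp : ContinuousOn lp (closure Ω))
    (hγp_exp : ThinDomain.HasUniformExpansion Ω (fun z => (γp z).1) γo kp)
    (hγm_exp : ThinDomain.HasUniformExpansion Ω (fun z => (γm z).1) (fun x => -γo x) km)
    (hβp_exp : ThinDomain.HasUniformExpansion Ω βp βo lp)
    (hβm_exp : ThinDomain.HasUniformExpansion Ω βm (fun x => -βo x) lm)
    (B : ThinDomain.Pt N → ℝ → ThinDomain.Pt N → ℝ) (hB : ThinDomain.IsLateralOp Ω B)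
    (ε₀ : ℝ) (hε₀ : 0 < ε₀) :
    ∃ ε₁ C₀ : ℝ, 0 < ε₁ ∧ ε₁ < ε₀ ∧ 0 < C₀ ∧ ∀ ε : ℝ, 0 < ε → ε < ε₁ →
      closure (ThinDomain.thin Ω gm gp ε) ⊆ ThinDomain.dataDomain Ω ∧
      (∃ u : ThinDomain.Pt N → ℝ,
        ThinDomain.IsViscositySolution Ω gm gp ε F γm γp βm βp B u) ∧
      ∀ u : ThinDomain.Pt N → ℝ,
        ThinDomain.IsViscositySolution Ω gm gp ε F γm γp βm βp B u →
          ∀ z ∈ closure (ThinDomain.thin Ω gm gp ε), |u z| ≤ C₀ := by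

  have hc := hΩb.isCompact_closure
  have dγp := hγp_exp.hasLinearDeviation hc hkp
  have dγm := hγm_exp.hasLinearDeviation hc hkm
  have dβp := hβp_exp.hasLinearDeviation hc hlp
  have dβm := hβm_exp.hasLinearDeviation hc hlm
  have hβo' : ThinDomain.IsC1On (fun x => -βo x) (closure Ω) := by
    obtain ⟨b, hb, hbe⟩ := hβo
    exact ⟨fun x => -b x, hb.neg, fun x hx => by simp only [hbe hx]⟩
  -- upper barrier, and lower barrier through the reflected data
  obtain ⟨C₁, hup⟩ := ThinDomain.exists_strict_supersolution hΩo hΩb hΩ1 hgm hgp hg hF hγm2 hγp2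
    hβo hγo dγp dγm dβp dβm hB
  obtain ⟨C₂, hlo⟩ := ThinDomain.exists_strict_supersolution hΩo hΩb hΩ1 hgm hgp hg hF.reflect
    hγm2 hγp2 hβo' hγo dγp dγm dβp.neg dβm.neg hB.reflect
  have hTB := ThinDomain.eventually_pointsInto_top_bottom hΩo hΩb hgm hgp hg hγm hγp hγm2 hγp2
  have hlat : ∀ᶠ ε : ℝ in 𝓝[>] 0, (∃ β, B = ThinDomain.dirichletOp β) ∨
      ∃ γ β, ∃ τ : ℝ, B = ThinDomain.obliqueOp γ β ∧ 0 < τ ∧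
      ∀ z ∈ ThinDomain.slab Ω gm gp ε, z.1 ∈ frontier Ω →
      (z.2 ≠ ε * gm z.1 → z.2 ≠ ε * gp z.1 →
        ThinDomain.PointsInto (ThinDomain.thin Ω gm gp ε) z (γ z)) ∧
      (z.2 = ε * gm z.1 →
        ThinDomain.PointsInto (ThinDomain.thin Ω gm gp ε) z (γ z + τ • γm z)) ∧
      (z.2 = ε * gp z.1 →
        ThinDomain.PointsInto (ThinDomain.thin Ω gm gp ε) z (γ z + τ • γp z)) := by
    rcases hB with ⟨γ, β, hγ, hβ, hpos, hγ0, rfl⟩ | ⟨β, hβ, rfl⟩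
    · obtain ⟨τ, hτ, h⟩ := ThinDomain.eventually_pointsInto_lateral hΩo hΩb hΩ1 hgm hgp hg hγm hγp
        hγm2 hγp2 hγ hpos hγ0
      filter_upwards [h] with ε h
      exact Or.inr ⟨γ, β, τ, rfl, hτ, h⟩
    · exact Filter.Eventually.of_forall fun ε => Or.inl ⟨β, rfl⟩
  obtain ⟨δ, hδ, hall⟩ := mem_nhdsGT_iff_exists_Ioo_subset.1
    ((ThinDomain.eventually_slab_subset hΩb hgm hgp).and
      (hup.and (hlo.and (hTB.and hlat))))
  have hδ : 0 < δ := hδ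
  refine ⟨min δ (ε₀ / 2), |C₁| + |C₂| + 1, by positivity,
    (min_le_right _ _).trans_lt (by linarith), by positivity, fun ε hε hε1 => ?_⟩
  obtain ⟨hsub, ⟨φ, hφ, hφC, hφF, hφB, hφm, hφp⟩, ⟨χ, hχ, hχC, hχF, hχB, hχm, hχp⟩, hTB, hlat⟩ :=
    hall ⟨hε, hε1.trans_le (min_le_left _ _)⟩
  have hKs := ThinDomain.closure_thin_subset_slab hgm hgp ε (Ω := Ω)
  have hKD := hKs.trans hsub
  have hK : IsCompact (closure (ThinDomain.thin Ω gm gp ε)) :=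
    (hc.prod isCompact_Icc).of_isClosed_subset isClosed_closure hKD
  -- the upper barrier is strict, also for larger values
  have hφs : ∀ z ∈ closure (ThinDomain.thin Ω gm gp ε), ∀ r, φ z < r →
      ¬ ThinDomain.SubIneq Ω gm gp ε F γm γp βm βp B
        (ThinDomain.hess φ z) (ThinDomain.grad φ z) r z := by
    intro z hz r hr
    have hzs := hKs hz
    refine ThinDomain.not_bdryIneq.2 ⟨?_, fun h => ?_, fun h => ?_, fun h => ?_⟩
    · exact (hφF z hzs).trans_le
        (hF.mono_right (ThinDomain.hess_isSymm hφ z) _ (hKD hz) hr.le)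
    · exact (hφB z hzs h.1).trans_le (hB.mono_right _ _ hr.le)
    · exact sub_pos.2 (hφm z hzs h.2)
    · exact sub_pos.2 (hφp z hzs h.2)
  have hχ' : ContDiff ℝ 2 fun w => -χ w := hχ.neg
  have hχs : ∀ z ∈ closure (ThinDomain.thin Ω gm gp ε), ∀ r, r ≤ -χ z →
      ¬ ThinDomain.SuperIneq Ω gm gp ε F γm γp βm βp B
        (ThinDomain.hess (fun w => -χ w) z) (ThinDomain.grad (fun w => -χ w) z) r z := by
    intro z hz r hr
    have hzs := hKs hz
    rw [ThinDomain.hess_neg, ThinDomain.grad_neg]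
    refine ThinDomain.not_bdryIneq.2 ⟨?_, fun h => ?_, fun h => ?_, fun h => ?_⟩
    · exact (hχF z hzs).trans_le (neg_le_neg
        (hF.mono_right (ThinDomain.hess_isSymm hχ z).neg _ (hKD hz) hr))
    · exact (hχB z hzs h.1).trans_le (neg_le_neg (hB.mono_right _ _ hr))
    · have := hχm z hzs h.2
      simp only [ThinDomain.dot_neg]; linarith
    · have := hχp z hzs h.2
      simp only [ThinDomain.dot_neg]; linarith
  have hclosed := ThinDomain.isClosedAlongJets_subIneq_superIneq hgm hgp hF hB hγm hγp hβm hβp hg hε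
    hsub
  refine ⟨hKD, ?_, fun u hu z hz => ?_⟩
  · obtain ⟨u, hub, h1, h2⟩ := ThinDomain.exists_isSub_isSuper hK hclosed.1 hclosed.2
      (fun φ χ hφ hχ z hz hmax hn => ThinDomain.subIneq_of_touching hΩo hgm hgp hF hsub hTB hlat
        hφ hχ hz hmax hn) (C := C₁)
      (fun v hv z hz => (hv.le_of_strict hK hφ hφs hz).trans (abs_le.1 (hφC z (hKs hz))).2)
      hχ' (fun z hz => hχs z hz _ le_rfl)
    exact ⟨u, (ThinDomain.isViscositySubsolution_iff hΩo hgm hgp hg hε).2 ⟨hub, h1⟩,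
      (ThinDomain.isViscositySupersolution_iff hΩo hgm hgp hg hε).2 ⟨hub, h2⟩⟩
  · obtain ⟨hub, h1⟩ := (ThinDomain.isViscositySubsolution_iff hΩo hgm hgp hg hε).1 hu.1
    obtain ⟨-, h2⟩ := (ThinDomain.isViscositySupersolution_iff hΩo hgm hgp hg hε).1 hu.2
    have a1 := (ThinDomain.le_uscEnv hub hz).trans (h1.le_of_strict hK hφ hφs hz)
    have a2 := (h2.le_of_strict hK hχ' (fun z hz r hr => hχs z hz r hr.le) hz).trans
      (ThinDomain.lscEnv_le hub hz)
    have b1 := abs_le.1 (hφC z (hKs hz))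
    have b2 := abs_le.1 (hχC z (hKs hz))
    have c1 := le_abs_self C₁
    have c2 := le_abs_self C₂
    have d1 := abs_nonneg C₁
    have d2 := abs_nonneg C₂
    exact abs_le.2 ⟨by linarith, by linarith⟩
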